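/- For positive integers $s,t$ let $K_{s,t}^{(3)}$ be the $3$-graph ($3$-uniform hypergraph) obtained from the complete bipartite graph $K_{s,t}$ by inserting one new vertex into each edge, the $st$ new vertices being distinct. A copy of $K_{s,t}^{(3)}$ in a $3$-graph $H$ is a subgraph of $H$ isomorphic to $K_{s,t}^{(3)}$. Let $t\ge s\ge 3$ be integers. Then: (1) There are constants $C,C'>0$, depending only on $s$ and $t$, such that for every integer $n\ge 2$ every $n$-vertex $3$-graph $H$ with $m\ge n^{3-\frac{3}{s}+\frac{1}{st}}(\log n)^{C}$ edges contains at least $(\log n)^{-C'}\,m^{st}n^{s+t-2st}$ copies of $K_{s,t}^{(3)}$. (2) The count in (1) is tight up to logarithmic factors: there is a constant $K>0$, depending only on $s$ and $t$, such that for all integers $n\ge 1$ and $0\le m\le\binom{n}{3}$ there is an $n$-vertex $3$-graph with exactly $m$ edges that contains at most $K\,m^{st}n^{s+t-2st}$ copies of $K_{s,t}^{(3)}$. -/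

import Mathlib

/-- An `r`-uniform hypergraph (`r`-graph) on the vertex type `V`: a finite family of `r`-element
sets of vertices. -/
structure RGraph (V : Type*) (r : ℕ) where
  /-- the edges -/
  edges : Finset (Finset V)
  /-- every edge has exactly `r` vertices -/
  uniform : ∀ e ∈ edges, e.card = r

namespace RGraph

theorem injective_pair (s t : ℕ) :
    Function.Injective (fun p : Fin s × Fin t => Finset.disjSum {p.1} {p.2}) := by
  intro p q h
  have h1 := congrArg Finset.toLeft h
  have h2 := congrArg Finset.toRight h
  simp only [Finset.toLeft_disjSum, Finset.toRight_disjSum, Finset.singleton_inj] at h1 h2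
  exact Prod.ext h1 h2

/-- The complete bipartite graph `K_{s,t}`, as a `2`-graph on the disjoint union of a part of size
`s` and a part of size `t`: its edges are the pairs with one vertex in each part. -/
def completeBipartite (s t : ℕ) : RGraph (Fin s ⊕ Fin t) 2 where
  edges := (Finset.univ : Finset (Fin s × Fin t)).map
    ⟨fun p => Finset.disjSum {p.1} {p.2}, injective_pair s t⟩
  uniform := by
    intro e he
    obtain ⟨p, -, rfl⟩ := Finset.mem_map.1 he
    exact Finset.card_disjSum {p.1} {p.2}

theorem injective_extend {W : Type*} (E : Finset (Finset W)) (k : ℕ) :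
    Function.Injective (fun e : {e // e ∈ E} =>
      Finset.disjSum e.1 (({e} : Finset {e // e ∈ E}) ×ˢ (Finset.univ : Finset (Fin k)))) := by
  intro e e' h
  have h1 := congrArg Finset.toLeft h
  simp only [Finset.toLeft_disjSum] at h1
  exact Subtype.ext h1

/-- The `r`-expansion of an `r₀`-graph `F`, for `r₀ ≤ r`: insert `r - r₀` new vertices into each
edge of `F`, all of them distinct. The new vertices of the edge `e` are the pairs `(e, i)` with
`i : Fin (r - r₀)`. -/
def expansion {W : Type*} {r₀ : ℕ} (F : RGraph W r₀) (r : ℕ) (hr : r₀ ≤ r) :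
    RGraph (W ⊕ ({e // e ∈ F.edges} × Fin (r - r₀))) r where
  edges := F.edges.attach.map
    ⟨fun e => Finset.disjSum e.1 ({e} ×ˢ Finset.univ), injective_extend F.edges (r - r₀)⟩
  uniform := by
    intro e he
    obtain ⟨p, -, rfl⟩ := Finset.mem_map.1 he
    have hp := F.uniform p.1 p.2
    have h : (Finset.disjSum p.1
        (({p} : Finset {e // e ∈ F.edges}) ×ˢ (Finset.univ : Finset (Fin (r - r₀))))).card = r := by
      rw [Finset.card_disjSum, Finset.card_product, Finset.card_singleton, Finset.card_univ,
        Fintype.card_fin, hp]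
      omega
    exact h

/-- The `3`-graph `K_{s,t}^{(3)}`, the `3`-expansion of `K_{s,t}`. -/
abbrev expandedK (s t : ℕ) :=
  (completeBipartite s t).expansion 3 (by norm_num)

/-- The copies of `F` in `H`, i.e. the subgraphs of `H` isomorphic to `F`. For `F` without isolated
vertices such a subgraph is determined by its set of edges, and it is recorded here as that set:
a set `σ` of edges of `H` that is the image of the edge set of `F` under an injection of the
vertices of `F` into those of `H`. Different injections with the same image give one copy. -/
def copies {W V : Type*} {r : ℕ} (F : RGraph W r) (H : RGraph V r) :
    Set (Finset (Finset V)) :=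
  {σ | σ ⊆ H.edges ∧ ∃ f : W ↪ V, σ = F.edges.map (Finset.mapEmbedding f).toEmbedding}

/-- The number of copies of `F` in `H`. -/
noncomputable def copyCount {W V : Type*} {r : ℕ} (F : RGraph W r) (H : RGraph V r) : ℕ :=
  (copies F H).ncard

end RGraph

section

open Finset

/-! Lower bound. If every pair of a biclique $K_{s,t}$ on the vertex set has codegree at least $d$,
with $d$ large compared with $st$, the new vertices can be chosen greedily in order $d^{st}$ ways.
So it suffices to count bicliques made of pairs of large codegree
(`card_mul_prod_le_mul_copyCount_expandedK`). Dyadic pigeonholing (`exists_regular_triples`) keeps a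
polylogarithmic proportion $T$ of the ordered edges $(x,y,z)$ on which the codegrees of $xy$, $zy$,
$zx$ and the degree of $z$ are constant up to a factor 2, say $a,b,c,D$.

Either the pairs of one of the three kinds exceed the Kővári–Sós–Turán threshold, and
supersaturation for graphs already gives the count (`copyCount_expandedK_ge_of_pairs`); or all three
kinds are sparse, which forces $a,b,c$ to be large. In the sparse case one counts $K_{s-1,t}$ in the
links of the vertices $z$ and adds $z$ as the last core vertex
(`copyCount_expandedK_ge_of_triples`). The power mean inequality is used twice: at most about $m/b$
pairs $(z,y)$ occur, and at most $|Z|(2D/c)^{s-1}$ pairs of a $z$ and an $(s-1)$-tuple of $x$'s,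
where $Z$ is the set of $z$ occurring in $T$. Writing $m=\mu n^{3-3/s}$, the result beats the
desired count by $(\mu^t/n^{1/s})^{s-1}$ up to logarithms (`supersaturation_estimate`); this is
where the threshold $\mu\ge n^{1/(st)}$ originates.

Tightness. A uniformly random set of $m$ triples contains a given set of $st$ triples with
probability at most $(m/\binom n3)^{st}$, and there are at most $n^{s+t+st}$ placements
(`exists_copyCount_mul_pow_le`). -/

/-! ### Greedy selection and biclique counting -/

/-- Greedy choice of distinct representatives: each choice avoids `A` and the representatives
already taken, at most `#A + card ι` vertices in all. -/
theorem exists_injective_selections {V : Type*} (ι : Type*) [Fintype ι] :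
    ∀ (S : ι → Finset V) (A : Finset V), ∃ F : Finset (ι → V),
      ∏ i, (#(S i) - (#A + Fintype.card ι)) ≤ #F ∧
        ∀ f ∈ F, Function.Injective f ∧ ∀ i, f i ∈ S i ∧ f i ∉ A := by
  classical
  refine Fintype.induction_empty_option (P := fun ι _ => ∀ (S : ι → Finset V) (A : Finset V),
    ∃ F : Finset (ι → V), ∏ i, (#(S i) - (#A + Fintype.card ι)) ≤ #F ∧
      ∀ f ∈ F, Function.Injective f ∧ ∀ i, f i ∈ S i ∧ f i ∉ A) ?_ ?_ ?_ ι
  · intro α β _ e ih S A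
    let _ := Fintype.ofEquiv _ e.symm
    obtain ⟨F, hF, hF'⟩ := ih (fun a => S (e a)) A
    refine ⟨F.map (e.arrowCongr (Equiv.refl V)).toEmbedding, ?_, ?_⟩
    · rw [card_map, ← Fintype.card_congr e, ← e.prod_comp]
      exact hF
    · intro f hf
      obtain ⟨g, hg, rfl⟩ := mem_map.1 hf
      obtain ⟨h1, h2⟩ := hF' g hg
      refine ⟨?_, fun i => ?_⟩
      · have : Function.Injective (g ∘ e.symm) := h1.comp e.symm.injective
        simpa [Equiv.arrowCongr] using this
      · simpa [Equiv.arrowCongr] using h2 (e.symm i)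
  · intro S A
    exact ⟨{PEmpty.elim}, by simp, fun f _ => ⟨fun x => x.elim, fun x => x.elim⟩⟩
  · intro α _ ih S A
    -- The representative `v` of `none` joins the forbidden set while the index set loses one
    -- element, so the amount subtracted in each factor stays the same.
    choose F hF hF' using fun v : V => ih (fun a => S (some a)) (insert v A)
    refine ⟨((S none \ A).sigma F).image (fun p o => Option.elim o p.1 p.2), ?_, ?_⟩
    · rw [card_image_of_injective, card_sigma, Fintype.prod_option]
      · calc _ ≤ #(S none \ A) *
              ∏ i, (#(S (some i)) - (#A + Fintype.card (Option α))) := by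
              gcongr
              have := le_card_sdiff A (S none)
              omega
          _ ≤ _ := by
              rw [← smul_eq_mul]
              refine card_nsmul_le_sum _ _ _ fun v hv => le_trans ?_ (hF v)
              rw [card_insert_of_notMem (mem_sdiff.1 hv).2, Fintype.card_option]
              exact le_of_eq (prod_congr rfl fun i _ => by congr 1; ring)
      · rintro ⟨v, f⟩ ⟨v', f'⟩ h
        have h0 : v = v' := congrFun h none
        have h1 : f = f' := funext fun a => congrFun h (some a)
        subst h0 h1
        rfl
    · intro f hf
      obtain ⟨⟨v, g⟩, hp, rfl⟩ := mem_image.1 hf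
      obtain ⟨hv, hg⟩ := mem_sigma.1 hp
      obtain ⟨h1, h2⟩ := hF' v g hg
      simp only [mem_sdiff] at hv
      have h3 : ∀ i, v ≠ g i := fun i h => (h2 i).2 (by simp [← h])
      refine ⟨?_, ?_⟩
      · rintro (_ | i) (_ | j) h
        · rfl
        · exact absurd h (h3 j)
        · exact absurd h.symm (h3 i)
        · exact congrArg some (h1 h)
      · rintro (_ | i)
        · exact hv
        · exact ⟨(h2 i).1, fun h => (h2 i).2 (mem_insert_of_mem h)⟩

/-- Power mean inequality for the number of injective `t`-tuples in the members of a family of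
finite sets, at most `Q` of which are non-empty. -/
theorem sum_card_injective_tuples_ge {ι V : Type*} [Fintype ι] [Fintype V] [DecidableEq V]
    (N : ι → Finset V) (t : ℕ) (Q : ℝ)
    (hQ : (#{i | (N i).Nonempty} : ℝ) ≤ Q) (h : 2 * (t + 1 : ℝ) * Q ≤ ∑ i, (#(N i) : ℝ)) :
    ((∑ i, (#(N i) : ℝ)) / 2) ^ (t + 1) / Q ^ t ≤
      ∑ i, (#{q : Fin (t + 1) → V | Function.Injective q ∧ ∀ j, q j ∈ N i} : ℝ) := by
  classical
  set I : Finset ι := {i | (N i).Nonempty} with hI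
  have hsum : ∑ i, (#(N i) : ℝ) = ∑ i ∈ I, (#(N i) : ℝ) := by
    rw [hI, sum_filter_of_ne]
    intro i _ hi
    rw [← card_pos]
    exact Nat.pos_of_ne_zero (by exact_mod_cast hi)
  clear_value I
  rcases I.eq_empty_or_nonempty with hemp | hne
  · rw [hsum, hemp]
    rw [sum_empty, zero_div, zero_pow (Nat.succ_ne_zero t), zero_div]
    exact sum_nonneg fun i _ => Nat.cast_nonneg _
  have hIpos : (0 : ℝ) < #I := by exact_mod_cast hne.card_pos
  have hQpos : 0 < Q := hIpos.trans_le hQ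
  -- Injectivity of a tuple of length `t + 1` costs at most `t + 1` choices per entry; by `h` these
  -- losses over the non-empty sets amount to at most half of the total size.
  set f : ι → ℝ := fun i => max ((#(N i) : ℝ) - (t + 1)) 0 with hf
  have h1 : ∀ i, f i ^ (t + 1) ≤
      (#{q : Fin (t + 1) → V | Function.Injective q ∧ ∀ j, q j ∈ N i} : ℝ) := by
    intro i
    obtain ⟨F, hF, hF'⟩ := exists_injective_selections (Fin (t + 1)) (fun _ => N i) ∅
    have hF2 : F ⊆ univ.filter fun q => Function.Injective q ∧ ∀ j, q j ∈ N i := by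
      intro q hq
      simp only [mem_filter, mem_univ, true_and]
      exact ⟨(hF' q hq).1, fun j => ((hF' q hq).2 j).1⟩
    have h2 := hF.trans (card_le_card hF2)
    simp only [prod_const, card_univ, Fintype.card_fin, card_empty, zero_add] at h2
    refine le_trans ?_ (Nat.cast_le (α := ℝ) |>.2 h2)
    push_cast
    gcongr
    refine max_le ?_ (by positivity)
    have h3 : #(N i) ≤ (#(N i) - (t + 1)) + (t + 1) := by omega
    have h4 : (#(N i) : ℝ) ≤ ((#(N i) - (t + 1) : ℕ) : ℝ) + (t + 1) := by exact_mod_cast h3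
    linarith
  have h2 : (∑ i, (#(N i) : ℝ)) / 2 ≤ ∑ i ∈ I, f i := by
    have : ∑ i ∈ I, ((#(N i) : ℝ) - (t + 1)) ≤ ∑ i ∈ I, f i :=
      sum_le_sum fun i _ => le_max_left _ _
    rw [sum_sub_distrib, ← hsum, sum_const, nsmul_eq_mul] at this
    have h5 : (#I : ℝ) * (t + 1) ≤ Q * (t + 1) := by gcongr
    linarith
  calc ((∑ i, (#(N i) : ℝ)) / 2) ^ (t + 1) / Q ^ t
      ≤ (∑ i ∈ I, f i) ^ (t + 1) / (#I : ℝ) ^ t := by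
        have h0 : 0 ≤ (∑ i, (#(N i) : ℝ)) / 2 :=
          div_nonneg (sum_nonneg fun i _ => Nat.cast_nonneg _) zero_le_two
        exact div_le_div₀ (pow_nonneg (h0.trans h2) _) (pow_le_pow_left₀ h0 h2 _)
          (pow_pos hIpos _) (pow_le_pow_left₀ hIpos.le hQ _)
    _ ≤ ∑ i ∈ I, f i ^ (t + 1) := by
        exact pow_sum_div_card_le_sum_pow (fun i _ => le_max_right _ _) t
    _ ≤ ∑ i, f i ^ (t + 1) := sum_le_sum_of_subset_of_nonneg (subset_univ _)
        fun i _ _ => pow_nonneg (le_max_right _ _) _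
    _ ≤ _ := sum_le_sum fun i _ => h1 i

/-- Supersaturation of `K_{r,t}` in a family of bipartite graphs indexed by `ζ`. -/
theorem card_bicliques_ge {ζ V : Type*} [Fintype ζ] [Fintype V] [DecidableEq V]
    (T : ζ → V → V → Prop) [∀ z y x, Decidable (T z y x)] (r t : ℕ) (e Q : ℝ) 
    (he : (#{p : ζ × V | ∃ x, T p.1 p.2 x} : ℝ) ≤ e)
    (hQ : (#{p : ζ × (Fin (r + 1) → V) | ∃ y, ∀ i, T p.1 y (p.2 i)} : ℝ) ≤ Q)
    (h1 : 2 * (r + 1 : ℝ) * e ≤ (#{p : (ζ × V) × V | T p.1.1 p.1.2 p.2} : ℝ))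
    (h2 : 2 * (t + 1 : ℝ) * Q ≤
      ((#{p : (ζ × V) × V | T p.1.1 p.1.2 p.2} : ℝ) / 2) ^ (r + 1) / e ^ r) :
    (((#{p : (ζ × V) × V | T p.1.1 p.1.2 p.2} : ℝ) / 2) ^ (r + 1) / e ^ r / 2) ^ (t + 1) /
        Q ^ t ≤
      (#{p : (ζ × (Fin (r + 1) → V)) × (Fin (t + 1) → V) | Function.Injective p.1.2 ∧
        Function.Injective p.2 ∧ ∀ i j, T p.1.1 (p.2 j) (p.1.2 i)} : ℝ) := by
  classical
  set S1 : ℝ := ((#{p : (ζ × V) × V | T p.1.1 p.1.2 p.2} : ℝ) / 2) ^ (r + 1) / e ^ r with hS1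
  have he0 : 0 ≤ e := le_trans (by positivity) he
  have hQ0 : 0 ≤ Q := le_trans (by positivity) hQ
  have hS10 : 0 ≤ S1 := by positivity
  have htot : (#{p : (ζ × V) × V | T p.1.1 p.1.2 p.2} : ℝ) =
      ∑ p : ζ × V, (#{x : V | T p.1 p.2 x} : ℝ) := by
    norm_cast
    rw [card_filter, Fintype.sum_prod_type]
    exact sum_congr rfl fun p _ => (card_filter _ _).symm
  have hstar : S1 ≤ ∑ p : ζ × V,
      (#{q : Fin (r + 1) → V | Function.Injective q ∧ ∀ j, T p.1 p.2 (q j)} : ℝ) := by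
    have := sum_card_injective_tuples_ge (fun p : ζ × V => ({x : V | T p.1 p.2 x} : Finset V)) r e
      (by simpa [Finset.Nonempty] using he) (by rw [← htot]; exact h1)
    rw [← htot] at this
    simpa using this
  -- Common neighbourhoods of leaf tuples. Stars are counted once by their centre and once by their
  -- leaves; the second power mean is taken over leaf tuples.
  let N : ζ × (Fin (r + 1) → V) → Finset V := fun p =>
    {y | Function.Injective p.2 ∧ ∀ i, T p.1 y (p.2 i)}
  have hswap : ∑ p : ζ × V,
      (#{q : Fin (r + 1) → V | Function.Injective q ∧ ∀ j, T p.1 p.2 (q j)} : ℝ) =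
      ∑ p, (#(N p) : ℝ) := by
    norm_cast
    rw [Fintype.sum_prod_type, Fintype.sum_prod_type]
    refine sum_congr rfl fun z _ => ?_
    exact sum_card_bipartiteAbove_eq_sum_card_bipartiteBelow
      (s := (univ : Finset V)) (t := (univ : Finset (Fin (r + 1) → V)))
      (fun y q => Function.Injective q ∧ ∀ j, T z y (q j))
  rw [hswap] at hstar
  have h3 := sum_card_injective_tuples_ge N t Q
    (le_trans (by
      norm_cast
      refine card_le_card fun p hp => ?_
      simp only [mem_filter, mem_univ, true_and, N, Finset.Nonempty] at hp ⊢
      obtain ⟨y, -, hy⟩ := hp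
      exact ⟨y, hy⟩) hQ) (h2.trans hstar)
  calc _ ≤ ((∑ i, (#(N i) : ℝ)) / 2) ^ (t + 1) / Q ^ t := by gcongr
    _ ≤ _ := h3
    _ = _ := by
      norm_cast
      symm
      rw [card_filter]
      refine (Fintype.sum_prod_type _).trans (sum_congr rfl fun p _ => ?_)
      rw [card_filter]
      refine sum_congr rfl fun q _ => ?_
      congr 1
      simp only [N, mem_filter, mem_univ, true_and, eq_iff_iff]
      constructor
      · rintro ⟨h1, h2, h3⟩
        exact ⟨h2, fun j => ⟨h1, fun i => h3 i j⟩⟩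
      · rintro ⟨h1, h2⟩
        exact ⟨(h2 0).1, h1, fun i j => (h2 j).2 i⟩

/-! ### From placements and bicliques to copies of the expansion -/

namespace RGraph

variable {V : Type*}

/-- The number of edges of a `3`-graph that contain the vertices `x ≠ y`. -/
def codegree [Fintype V] [DecidableEq V] (H : RGraph V 3) (x y : V) : ℕ :=
  #{z | ({x, y, z} : Finset V) ∈ H.edges}

theorem ne_of_triple_mem [DecidableEq V] (H : RGraph V 3) {x y z : V}
    (h : ({x, y, z} : Finset V) ∈ H.edges) : x ≠ y ∧ x ≠ z ∧ y ≠ z := by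
  have := H.uniform _ h
  refine ⟨?_, ?_, ?_⟩ <;> rintro rfl
  · rw [insert_idem] at this
    exact absurd card_le_two (by omega : ¬ #{x, z} ≤ 2)
  · rw [insert_comm, pair_eq_singleton] at this
    exact absurd card_le_two (by omega : ¬ #{y, x} ≤ 2)
  · rw [pair_eq_singleton] at this
    exact absurd card_le_two (by omega : ¬ #{x, y} ≤ 2)

theorem card_edges_completeBipartite (s t : ℕ) : #(completeBipartite s t).edges = s * t := by
  simp [completeBipartite]

theorem card_edges_expandedK (s t : ℕ) : #(expandedK s t).edges = s * t := by
  simp [expansion, card_edges_completeBipartite]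

/-- An injective placement of the vertices of `K_{s,t}^{(3)}` in `V` whose edges lie in `H` gives
a copy of `K_{s,t}^{(3)}`. -/
theorem image_mem_copies_expandedK [DecidableEq V] (H : RGraph V 3) {s t : ℕ}
    (g : (Fin s ⊕ Fin t) ⊕ (Fin s × Fin t) → V) (hg : Function.Injective g)
    (hE : ∀ i j, ({g (.inl (.inl i)), g (.inl (.inr j)), g (.inr (i, j))} : Finset V) ∈ H.edges) :
    (univ.image fun p : Fin s × Fin t =>
      ({g (.inl (.inl p.1)), g (.inl (.inr p.2)), g (.inr p)} : Finset V)) ∈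
      copies (expandedK s t) H := by
  have key : ∀ e : {e // e ∈ (completeBipartite s t).edges}, ∃ p : Fin s × Fin t,
      disjSum {p.1} {p.2} = e.1 := by
    rintro ⟨e, he⟩
    obtain ⟨p, -, hp⟩ := mem_map.1 he
    exact ⟨p, hp⟩
  choose φ hφ using key
  have hφi : Function.Injective φ := fun e e' h => Subtype.ext (by rw [← hφ, ← hφ, h])
  have hφs : ∀ p, ∃ e, φ e = p := fun p =>
    ⟨⟨disjSum {p.1} {p.2}, mem_map.2 ⟨p, mem_univ _, rfl⟩⟩, injective_pair s t (hφ _)⟩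
  let f : (Fin s ⊕ Fin t) ⊕ ({e // e ∈ (completeBipartite s t).edges} × Fin (3 - 2)) ↪ V :=
    ⟨g ∘ Sum.map id (fun q => φ q.1), hg.comp (Sum.map_injective.2 ⟨Function.injective_id,
      fun a b h => Prod.ext (hφi h) (Subsingleton.elim (α := Fin 1) _ _)⟩)⟩
  have hmap : ∀ e : {e // e ∈ (completeBipartite s t).edges},
      (disjSum e.1 (({e} : Finset {e // e ∈ (completeBipartite s t).edges}) ×ˢ
        (univ : Finset (Fin (3 - 2))))).map f =
      {g (.inl (.inl (φ e).1)), g (.inl (.inr (φ e).2)), g (.inr (φ e))} := by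
    intro e
    ext v
    simp only [mem_map, mem_disjSum, mem_product, mem_singleton, mem_univ, and_true, mem_insert]
    constructor
    · rintro ⟨a, ⟨b, hb, rfl⟩ | ⟨b, hb, rfl⟩, rfl⟩
      · rw [← hφ e, mem_disjSum] at hb
        obtain ⟨i, hi, rfl⟩ | ⟨j, hj, rfl⟩ := hb
        · rw [mem_singleton] at hi
          exact .inl (by simp [f, hi])
        · rw [mem_singleton] at hj
          exact .inr (.inl (by simp [f, hj]))
      · exact .inr (.inr (by simp [f, hb]))
    · rintro (rfl | rfl | rfl)
      · exact ⟨_, .inl ⟨.inl (φ e).1, by rw [← hφ e]; simp, rfl⟩, by simp [f]⟩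
      · exact ⟨_, .inl ⟨.inr (φ e).2, by rw [← hφ e]; simp, rfl⟩, by simp [f]⟩
      · exact ⟨_, .inr ⟨(e, (0 : Fin 1)), rfl, rfl⟩, by simp [f]⟩
  refine ⟨?_, f, ?_⟩
  · intro e he
    obtain ⟨p, -, rfl⟩ := mem_image.1 he
    exact hE _ _
  · ext e
    simp only [mem_image, mem_univ, true_and, expansion, mem_map, mem_attach,
      Function.Embedding.coeFn_mk, RelEmbedding.coe_toEmbedding, mapEmbedding_apply,
      exists_exists_eq_and, hmap]
    constructor
    · rintro ⟨p, rfl⟩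
      obtain ⟨e, rfl⟩ := hφs p
      exact ⟨e, rfl⟩
    · rintro ⟨e, rfl⟩
      exact ⟨φ e, rfl⟩

/-- A copy spans at most `3 * (s * t)` vertices, and every placement producing it takes values among
them. Positivity of `s` and `t` puts every core vertex in some edge. -/
theorem card_le_mul_copyCount_expandedK [Fintype V] [DecidableEq V] (H : RGraph V 3) {s t : ℕ}
    (hs : 0 < s) (ht : 0 < t) (G : Finset ((Fin s ⊕ Fin t) ⊕ (Fin s × Fin t) → V))
    (hG : ∀ g ∈ G, Function.Injective g ∧ ∀ i j,
      ({g (.inl (.inl i)), g (.inl (.inr j)), g (.inr (i, j))} : Finset V) ∈ H.edges) :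
    #G ≤ (3 * (s * t)) ^ (s + t + s * t) * copyCount (expandedK s t) H := by
  classical
  let σ : ((Fin s ⊕ Fin t) ⊕ (Fin s × Fin t) → V) → Finset (Finset V) := fun g =>
    univ.image fun p : Fin s × Fin t =>
      ({g (.inl (.inl p.1)), g (.inl (.inr p.2)), g (.inr p)} : Finset V)
  have h1 : #(G.image σ) ≤ copyCount (expandedK s t) H := by
    rw [copyCount, ← Set.ncard_coe_finset]
    refine Set.ncard_le_ncard ?_ (Set.toFinite _)
    intro τ hτ
    obtain ⟨g, hg, rfl⟩ := mem_image.1 (mem_coe.1 hτ)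
    exact image_mem_copies_expandedK H g (hG g hg).1 (hG g hg).2
  refine (card_le_mul_card_image G _ fun τ hτ => ?_).trans (Nat.mul_le_mul_left _ h1)
  obtain ⟨g₀, hg₀, rfl⟩ := mem_image.1 hτ
  have h2 : #((σ g₀).biUnion id) ≤ 3 * (s * t) := by
    rw [mul_comm]
    refine (card_biUnion_le_card_mul _ _ 3 fun e he => ?_).trans
      (Nat.mul_le_mul_right _ (card_image_le.trans (by simp)))
    obtain ⟨p, -, rfl⟩ := mem_image.1 he
    exact card_le_three
  have h3 : {g ∈ G | σ g = σ g₀} ⊆ Fintype.piFinset fun _ => (σ g₀).biUnion id := by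
    intro g hg
    rw [mem_filter] at hg
    rw [← hg.2, Fintype.mem_piFinset]
    intro a
    have : ∀ p : Fin s × Fin t, ∀ v ∈ ({g (.inl (.inl p.1)), g (.inl (.inr p.2)),
        g (.inr p)} : Finset V), v ∈ (σ g).biUnion id := fun p v hv =>
      mem_biUnion.2 ⟨_, mem_image.2 ⟨p, mem_univ _, rfl⟩, hv⟩
    rcases a with (i | j) | p
    · exact this (i, ⟨0, ht⟩) _ (by simp)
    · exact this (⟨0, hs⟩, j) _ (by simp)
    · exact this p _ (by simp)
  refine (card_le_card h3).trans ?_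
  rw [Fintype.card_piFinset, prod_const, card_univ]
  simp only [Fintype.card_sum, Fintype.card_fin, Fintype.card_prod]
  exact Nat.pow_le_pow_left h2 _

/-- Extending the copies of `K_{s,t}` in a set of pairs of large codegree to copies of
`K_{s,t}^{(3)}`. -/
theorem card_mul_prod_le_mul_copyCount_expandedK [Fintype V] [DecidableEq V] (H : RGraph V 3)
    {s t : ℕ} (hs : 0 < s) (ht : 0 < t) (𝒞 : Finset ((Fin s → V) × (Fin t → V)))
    (k : Fin s → Fin t → ℕ) (hk : ∀ i j, 0 < k i j)
    (hC : ∀ c ∈ 𝒞, Function.Injective c.1 ∧ Function.Injective c.2 ∧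
      ∀ i j, k i j ≤ H.codegree (c.1 i) (c.2 j)) :
    #𝒞 * ∏ i, ∏ j, (k i j - (s + t + s * t)) ≤
      (3 * (s * t)) ^ (s + t + s * t) * copyCount (expandedK s t) H := by
  classical
  -- For each biclique, the new vertices are distinct representatives of the sets of third vertices
  -- of its pairs, chosen away from the core.
  choose F hF hF' using fun c : (Fin s → V) × (Fin t → V) =>
    exists_injective_selections (Fin s × Fin t)
      (fun p => ({z | ({c.1 p.1, c.2 p.2, z} : Finset V) ∈ H.edges} : Finset V))
      (univ.image c.1 ∪ univ.image c.2)
  let Φ : (Σ _ : (Fin s → V) × (Fin t → V), Fin s × Fin t → V) →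
      ((Fin s ⊕ Fin t) ⊕ (Fin s × Fin t) → V) := fun c => Sum.elim (Sum.elim c.1.1 c.1.2) c.2
  have hΦ : Function.Injective Φ := by
    rintro ⟨⟨p, q⟩, w⟩ ⟨⟨p', q'⟩, w'⟩ h
    have h1 : p = p' := funext fun i => congrFun h (.inl (.inl i))
    have h2 : q = q' := funext fun i => congrFun h (.inl (.inr i))
    have h3 : w = w' := funext fun i => congrFun h (.inr i)
    subst h1 h2 h3
    rfl
  refine le_trans ?_ (card_le_mul_copyCount_expandedK H hs ht ((𝒞.sigma F).image Φ) ?_)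
  · rw [card_image_of_injective _ hΦ, card_sigma, ← smul_eq_mul]
    refine card_nsmul_le_sum _ _ _ fun c hc => le_trans ?_ (hF c)
    rw [Fintype.prod_prod_type]
    refine prod_le_prod' fun i _ => prod_le_prod' fun j _ => ?_
    have h1 := (hC c hc).2.2 i j
    have h2 : #(univ.image c.1 ∪ univ.image c.2) ≤ s + t :=
      (card_union_le _ _).trans (Nat.add_le_add (card_image_le.trans (by simp))
        (card_image_le.trans (by simp)))
    rw [Fintype.card_prod, Fintype.card_fin, Fintype.card_fin]
    exact tsub_le_tsub (by exact h1) (Nat.add_le_add_right h2 _)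
  · intro g hg
    obtain ⟨⟨⟨p, q⟩, w⟩, hc, rfl⟩ := mem_image.1 hg
    obtain ⟨hc, hw⟩ := mem_sigma.1 hc
    obtain ⟨h1, h2, h3⟩ := hC _ hc
    obtain ⟨h4, h5⟩ := hF' _ w hw
    simp only [mem_filter, mem_univ, true_and, mem_union, mem_image, not_or, not_exists] at h5
    refine ⟨?_, fun i j => (h5 (i, j)).1⟩
    refine Function.Injective.sumElim (Function.Injective.sumElim h1 h2 ?_) h4 ?_
    · intro i j
      -- Positive codegree makes the two sides of the core disjoint: a pair lying in an edge has
      -- distinct ends.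
      have h6 := (hk i j).trans_le (h3 i j)
      obtain ⟨z, hz⟩ := card_pos.1 h6
      exact (ne_of_triple_mem H (mem_filter.1 hz).2).1
    · rintro (i | j) ij
      · exact (h5 ij).2.1 i
      · exact (h5 ij).2.2 j

end RGraph

/-! ### Tightness by averaging over hypergraphs with m edges -/

/-- The ratio of binomials is a product of factors $(m-i)/(N-i)$, each at most $m/N$. -/
theorem Nat.choose_sub_mul_pow_le {N m : ℕ} (hm : m ≤ N) :
    ∀ k ≤ m, (N - k).choose (m - k) * N ^ k ≤ N.choose m * m ^ k := by
  intro k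
  induction k with
  | zero => simp
  | succ k ih =>
    intro hk
    have ih := ih (by omega)
    obtain ⟨a, ha⟩ : ∃ a, N - k = a + 1 := ⟨N - k - 1, by omega⟩
    obtain ⟨b, hb⟩ : ∃ b, m - k = b + 1 := ⟨m - k - 1, by omega⟩
    have ha' : N - (k + 1) = a := by omega
    have hb' : m - (k + 1) = b := by omega
    rw [ha, hb] at ih
    rw [ha', hb']
    have h1 := Nat.add_one_mul_choose_eq a b
    have hN : N = a + 1 + k := by omega
    have hmk : m = b + 1 + k := by omega
    have h2 : (b + 1) * N ≤ m * (a + 1) := by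
      have : b ≤ a := by omega
      rw [hN, hmk]
      nlinarith [Nat.mul_le_mul_right k this]
    refine Nat.le_of_mul_le_mul_left (c := a + 1) ?_ (Nat.succ_pos a)
    calc (a + 1) * (a.choose b * N ^ (k + 1))
        = (a + 1).choose (b + 1) * N ^ k * ((b + 1) * N) := by
          rw [← mul_assoc, h1]; ring
      _ ≤ (N.choose m * m ^ k) * (m * (a + 1)) := Nat.mul_le_mul ih h2
      _ = _ := by ring

/-- This bounds by $(m/|E|)^{|σ|}$ the probability that a random $m$-subset of $E$ contains $σ$:
deleting $σ$ is injective on the sets containing it. -/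
theorem Finset.card_filter_superset_powersetCard_mul_pow_le {α : Type*} [DecidableEq α]
    (E σ : Finset α) {m : ℕ} (hm : m ≤ #E) :
    #{A ∈ powersetCard m E | σ ⊆ A} * #E ^ #σ ≤ (#E).choose m * m ^ #σ := by
  rcases eq_empty_or_nonempty {A ∈ powersetCard m E | σ ⊆ A} with h | ⟨A₀, hA₀⟩
  · rw [h]
    simp
  · simp only [mem_filter, mem_powersetCard] at hA₀
    have hk : #σ ≤ m := hA₀.1.2 ▸ card_le_card hA₀.2
    have hσ : σ ⊆ E := hA₀.2.trans hA₀.1.1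
    refine le_trans (Nat.mul_le_mul_right _ ?_) (Nat.choose_sub_mul_pow_le hm _ hk)
    rw [← card_sdiff_of_subset hσ, ← card_powersetCard]
    refine card_le_card_of_injOn (fun A => A \ σ) ?_ ?_
    · intro A hA
      simp only [coe_filter, mem_powersetCard, Set.mem_ofPred_eq] at hA
      simp only [mem_coe, mem_powersetCard]
      exact ⟨sdiff_subset_sdiff hA.1.1 (Subset.refl _), by
        rw [card_sdiff_of_subset hA.2, hA.1.2]⟩
    · intro A hA B hB h
      simp only [coe_filter, mem_powersetCard, Set.mem_ofPred_eq] at hA hB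
      rw [← sdiff_union_of_subset hA.2, ← sdiff_union_of_subset hB.2]
      exact congrArg (· ∪ σ) h

namespace RGraph

/-- Averaging over all hypergraphs with `m` edges. -/
theorem exists_copyCount_mul_pow_le {W : Type*} [Fintype W] {r : ℕ} (F : RGraph W r) (n m : ℕ)
    (hm : m ≤ n.choose r) : ∃ H : RGraph (Fin n) r, #H.edges = m ∧
      copyCount F H * n.choose r ^ #F.edges ≤ n ^ Fintype.card W * m ^ #F.edges := by
  classical
  obtain ⟨E, hE⟩ : ∃ E : Finset (Finset (Fin n)), E = powersetCard r univ := ⟨_, rfl⟩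
  have hEc : #E = n.choose r := by simp [hE]
  let σ : (W ↪ Fin n) → Finset (Finset (Fin n)) := fun f =>
    F.edges.map (mapEmbedding f).toEmbedding
  have hσ : ∀ f, #(σ f) = #F.edges := fun f => card_map _
  have hsum : ∑ A ∈ powersetCard m E, #{f : W ↪ Fin n | σ f ⊆ A} * #E ^ #F.edges ≤
      ∑ A ∈ powersetCard m E, n ^ Fintype.card W * m ^ #F.edges := by
    rw [← sum_mul, sum_const, smul_eq_mul, card_powersetCard]
    have hswap : ∑ A ∈ powersetCard m E, #{f : W ↪ Fin n | σ f ⊆ A} =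
        ∑ f : W ↪ Fin n, #{A ∈ powersetCard m E | σ f ⊆ A} :=
      sum_card_bipartiteAbove_eq_sum_card_bipartiteBelow (fun A f => σ f ⊆ A)
    rw [hswap, sum_mul]
    calc ∑ f : W ↪ Fin n, #{A ∈ powersetCard m E | σ f ⊆ A} * #E ^ #F.edges
        ≤ ∑ _f : W ↪ Fin n, (#E).choose m * m ^ #F.edges := sum_le_sum fun f _ => by
          have := card_filter_superset_powersetCard_mul_pow_le E (σ f) (hEc ▸ hm)
          rwa [hσ] at this
      _ ≤ n ^ Fintype.card W * ((#E).choose m * m ^ #F.edges) := by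
          rw [sum_const, smul_eq_mul, card_univ, Fintype.card_embedding_eq, Fintype.card_fin]
          exact Nat.mul_le_mul_right _ (Nat.descFactorial_le_pow _ _)
      _ = _ := by ring
  obtain ⟨A, hA, hle⟩ := exists_le_of_sum_le (powersetCard_nonempty.2 (hEc ▸ hm)) hsum
  rw [mem_powersetCard] at hA
  refine ⟨⟨A, fun e he => (mem_powersetCard.1 (hE ▸ hA.1 he)).2⟩, hA.2, ?_⟩
  rw [hEc] at hle
  refine le_trans (Nat.mul_le_mul_right _ ?_) hle
  rw [copyCount]
  refine le_trans (Set.ncard_le_ncard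
    (t := ((univ.filter fun f => σ f ⊆ A).image σ : Finset (Finset (Finset (Fin n)))))
    ?_ (Set.toFinite _)) ?_
  · rintro τ ⟨h1, f, rfl⟩
    exact mem_coe.2 (mem_image.2 ⟨f, by rw [mem_filter]; exact ⟨mem_univ _, h1⟩, rfl⟩)
  · rw [Set.ncard_coe_finset]
    exact card_image_le

theorem copyCount_eq_zero {W V : Type*} {r : ℕ} (F : RGraph W r) (H : RGraph V r)
    (hF : 0 < #F.edges) (hH : #H.edges = 0) : copyCount F H = 0 := by
  rw [copyCount, ← Set.ncard_empty]
  congr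
  rw [Set.eq_empty_iff_forall_notMem]
  rintro σ ⟨h1, f, rfl⟩
  have := card_le_card h1
  rw [card_map] at this
  omega

theorem exists_copyCount_expandedK_le (s t : ℕ) (hs : 0 < s) (ht : 0 < t) (n m : ℕ)
    (hm : m ≤ n.choose 3) : ∃ H : RGraph (Fin n) 3, #H.edges = m ∧
      (copyCount (expandedK s t) H : ℝ) ≤
        27 ^ (s * t) * ((m : ℝ) ^ (s * t) * (n : ℝ) ^ ((s : ℝ) + t - 2 * s * t)) := by
  obtain ⟨H, hH, hle⟩ := exists_copyCount_mul_pow_le (expandedK s t) n m hm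
  refine ⟨H, hH, ?_⟩
  have hst : 0 < s * t := Nat.mul_pos hs ht
  rcases Nat.eq_zero_or_pos m with rfl | hm0
  · rw [copyCount_eq_zero _ _ (by rw [card_edges_expandedK]; exact hst) hH]
    simp only [Nat.cast_zero, zero_pow hst.ne']
    simp
  have hn : 3 ≤ n := by
    by_contra h
    rw [Nat.choose_eq_zero_of_lt (by omega)] at hm
    omega
  -- The constant 27 is attained at `n = 3`.
  have hN : n ^ 3 ≤ 27 * n.choose 3 := by
    obtain ⟨a, rfl⟩ : ∃ a, n = a + 3 := ⟨n - 3, by omega⟩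
    have h1 := Nat.descFactorial_eq_factorial_mul_choose (a + 3) 3
    have h2 : (a + 3).descFactorial 3 = (a + 1) * ((a + 2) * (a + 3)) := by
      simp [Nat.descFactorial]
    have h3 : Nat.factorial 3 = 6 := rfl
    rw [h2, h3] at h1
    nlinarith
  have hW : Fintype.card ((Fin s ⊕ Fin t) ⊕
      ({e // e ∈ (completeBipartite s t).edges} × Fin (3 - 2))) = s + t + s * t := by
    simp [card_edges_completeBipartite]
  rw [hW, card_edges_expandedK] at hle
  have hn0 : (0 : ℝ) < n := by exact_mod_cast (by omega : 0 < n)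
  have hrp : (n : ℝ) ^ ((s : ℝ) + t - 2 * s * t) =
      (n : ℝ) ^ (s + t + s * t) / ((n : ℝ) ^ 3) ^ (s * t) := by
    rw [← pow_mul, ← Real.rpow_natCast, ← Real.rpow_natCast, ← Real.rpow_sub hn0]
    congr 1
    push_cast
    ring
  have hNr : ((n : ℝ) ^ 3) ^ (s * t) ≤ 27 ^ (s * t) * (n.choose 3 : ℝ) ^ (s * t) := by
    rw [← mul_pow]
    gcongr
    exact_mod_cast hN
  have hler : (copyCount (expandedK s t) H : ℝ) * (n.choose 3 : ℝ) ^ (s * t) ≤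
      (n : ℝ) ^ (s + t + s * t) * (m : ℝ) ^ (s * t) := by exact_mod_cast hle
  rw [hrp, mul_div_assoc', mul_div_assoc', le_div_iff₀ (by positivity)]
  calc _ ≤ (copyCount (expandedK s t) H : ℝ) * (27 ^ (s * t) * (n.choose 3 : ℝ) ^ (s * t)) := by
        gcongr
    _ = 27 ^ (s * t) * ((copyCount (expandedK s t) H : ℝ) * (n.choose 3 : ℝ) ^ (s * t)) := by
        ring
    _ ≤ 27 ^ (s * t) * ((n : ℝ) ^ (s + t + s * t) * (m : ℝ) ^ (s * t)) := by gcongr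
    _ = _ := by ring

end RGraph

/-! ### Copies from dense pairs and from links -/

namespace RGraph

variable {V : Type*} [Fintype V] [DecidableEq V]

theorem codegree_comm (H : RGraph V 3) (x y : V) : H.codegree x y = H.codegree y x := by
  simp only [codegree, insert_comm x y]

/-- The ordered triples of vertices that form an edge. -/
def triples (H : RGraph V 3) : Finset (V × V × V) :=
  {p | ({p.1, p.2.1, p.2.2} : Finset V) ∈ H.edges}

/-- The number of ordered pairs of vertices that form an edge with `z`. -/
def pairDegree (H : RGraph V 3) (z : V) : ℕ := ∑ x, H.codegree z x

theorem mem_triples (H : RGraph V 3) {x y z : V} :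
    (x, y, z) ∈ H.triples ↔ ({x, y, z} : Finset V) ∈ H.edges := by
  simp [triples]

theorem sum_pairDegree (H : RGraph V 3) : ∑ z, H.pairDegree z = #H.triples := by
  simp only [pairDegree, codegree, triples, card_filter]
  rw [Fintype.sum_prod_type]
  exact sum_congr rfl fun x _ => by rw [Fintype.sum_prod_type]

theorem card_mul_le_card_triples (H : RGraph V 3) (Z : Finset V) {D : ℕ}
    (hD : ∀ z ∈ Z, D ≤ H.pairDegree z) : #Z * D ≤ #H.triples := by
  rw [← sum_pairDegree, ← smul_eq_mul]
  exact (card_nsmul_le_sum _ _ _ hD).trans (sum_le_sum_of_subset (subset_univ _))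

theorem card_pairs_mul_le_card_triples (H : RGraph V 3) (P : Finset (V × V)) {b : ℕ}
    (hb : ∀ p ∈ P, b ≤ H.codegree p.1 p.2) : #P * b ≤ #H.triples := by
  rw [← sum_pairDegree, ← smul_eq_mul]
  simp only [pairDegree]
  rw [← Fintype.sum_prod_type fun p : V × V => H.codegree p.1 p.2]
  exact (card_nsmul_le_sum _ _ _ hb).trans (sum_le_sum_of_subset (subset_univ _))

theorem card_mul_le_pairDegree (H : RGraph V 3) (z : V) (X : Finset V) {c : ℕ}
    (hc : ∀ x ∈ X, c ≤ H.codegree z x) : #X * c ≤ H.pairDegree z := by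
  rw [← smul_eq_mul]
  exact (card_nsmul_le_sum _ _ _ hc).trans (sum_le_sum_of_subset (subset_univ _))

theorem card_edges_le_card_triples (H : RGraph V 3) : #H.edges ≤ #H.triples := by
  have : H.edges ⊆ H.triples.image fun p => {p.1, p.2.1, p.2.2} := by
    intro e he
    obtain ⟨x, y, z, -, -, -, rfl⟩ := card_eq_three.1 (H.uniform e he)
    exact mem_image.2 ⟨(x, y, z), H.mem_triples.2 he, rfl⟩
  exact (card_le_card this).trans card_image_le

theorem half_le_natCast_sub {k w : ℕ} (h : 2 * w ≤ k) : (k : ℝ) / 2 ≤ ((k - w : ℕ) : ℝ) := by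
  rw [Nat.cast_sub (by omega)]
  have : (2 * w : ℝ) ≤ k := by exact_mod_cast h
  linarith

/-- A set of pairs of codegree at least `k` yields the expected number of copies of
`K_{s,t}^{(3)}`, unless it is sparse. -/
theorem copyCount_expandedK_ge_of_pairs (H : RGraph V 3) (r q : ℕ) (P : Finset (V × V))
    (U : Finset V) (k : ℕ) (hP : ∀ p ∈ P, p.1 ∈ U ∧ k ≤ H.codegree p.1 p.2)
    (hk : 2 * (r + 1 + (q + 1) + (r + 1) * (q + 1)) ≤ k) (θ : ℝ) (hθ0 : 0 ≤ θ)
    (hθ : θ ≤ #P * k) :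
    θ ^ ((r + 1) * (q + 1)) * (Fintype.card V : ℝ) ^ (r + 1 + (q + 1)) ≤
      (4 ^ ((r + 1) * (q + 1)) * 2 ^ (q + 1) * (3 * ((r + 1) * (q + 1))) ^
        (r + 1 + (q + 1) + (r + 1) * (q + 1))) * copyCount (expandedK (r + 1) (q + 1)) H *
        (Fintype.card V : ℝ) ^ (2 * ((r + 1) * (q + 1))) ∨
    θ ^ (r + 1) ≤ ((2 * (r + 1)) ^ (r + 1) + 2 * (q + 1) * 2 ^ (r + 1)) * (k : ℝ) ^ (r + 1) *
      (#U : ℝ) ^ r * (Fintype.card V : ℝ) ^ (r + 1) := by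
  refine or_iff_not_imp_right.2 fun hnot => ?_
  rw [not_le] at hnot
  set n : ℝ := (Fintype.card V : ℝ) with hn
  set w := r + 1 + (q + 1) + (r + 1) * (q + 1) with hw
  have hk0 : (0 : ℝ) < k := by
    have : 0 < k := by omega
    exact_mod_cast this
  have hPpos : 0 < #P := by
    by_contra h
    have : #P = 0 := by omega
    rw [this] at hθ
    have : θ = 0 := le_antisymm (by simpa using hθ) hθ0
    rw [this, zero_pow (Nat.succ_ne_zero r)] at hnot
    exact absurd hnot (not_lt.2 (by positivity))
  obtain ⟨p₀, hp₀⟩ := card_pos.1 hPpos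
  have hU : 1 ≤ #U := card_pos.2 ⟨_, (hP _ hp₀).1⟩
  have hUr : (1 : ℝ) ≤ (#U : ℝ) := by exact_mod_cast hU
  have hUn : (#U : ℝ) ≤ n := by
    rw [hn]
    exact_mod_cast card_le_univ U
  have hn1 : 1 ≤ n := hUr.trans hUn
  have hPr : ((2 * (r + 1 : ℝ)) ^ (r + 1) + 2 * (q + 1) * 2 ^ (r + 1)) * (#U : ℝ) ^ r *
      n ^ (r + 1) < (#P : ℝ) ^ (r + 1) := by
    have h1 : θ ^ (r + 1) ≤ (#P : ℝ) ^ (r + 1) * (k : ℝ) ^ (r + 1) := by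
      rw [← mul_pow]
      exact pow_le_pow_left₀ hθ0 hθ _
    have h2 := hnot.trans_le h1
    refine lt_of_mul_lt_mul_right (a := (k : ℝ) ^ (r + 1)) (lt_of_eq_of_lt ?_ h2) (by positivity)
    ring
  classical
  have hu0 : (0 : ℝ) < (#U : ℝ) ^ r := by positivity
  have htot : #{p : (Unit × V) × V | (p.1.2, p.2) ∈ P} = #P := by
    refine card_nbij' (fun p => (p.1.2, p.2)) (fun p => (((), p.1), p.2)) ?_ ?_ ?_ ?_
    · intro p hp; simpa using hp
    · intro p hp; simpa using hp
    · rintro ⟨⟨⟨⟩, y⟩, x⟩ _; rfl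
    · intro p _; rfl
  -- A single bipartite graph: star centres lie in `U`, and leaf tuples are bounded trivially by `n
  -- ^ (r + 1)`. Failure of the sparse alternative supplies both density conditions.
  have key := card_bicliques_ge (fun (_ : Unit) y x => (y, x) ∈ P) r q #U (n ^ (r + 1)) ?_ ?_ ?_ ?_
  · rw [htot] at key
    set B := #{p : (Unit × (Fin (r + 1) → V)) × (Fin (q + 1) → V) | Function.Injective p.1.2 ∧
      Function.Injective p.2 ∧ ∀ i j, (p.2 j, p.1.2 i) ∈ P} with hB
    have hcore := card_mul_prod_le_mul_copyCount_expandedK H (Nat.succ_pos r) (Nat.succ_pos q)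
      ((univ.filter fun p : (Unit × (Fin (r + 1) → V)) × (Fin (q + 1) → V) =>
        Function.Injective p.1.2 ∧ Function.Injective p.2 ∧
          ∀ i j, (p.2 j, p.1.2 i) ∈ P).image fun p => (p.1.2, p.2)) (fun _ _ => k)
      (fun _ _ => by omega) (by
        intro c hc
        obtain ⟨p, hp, rfl⟩ := mem_image.1 hc
        simp only [mem_filter, mem_univ, true_and] at hp
        refine ⟨hp.1, hp.2.1, fun i j => ?_⟩
        rw [codegree_comm]
        exact (hP _ (hp.2.2 i j)).2)
    rw [card_image_of_injective] at hcore
    swap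
    · rintro ⟨⟨⟨⟩, y⟩, x⟩ ⟨⟨⟨⟩, y'⟩, x'⟩ h
      simp only [Prod.mk.injEq] at h ⊢
      exact ⟨⟨trivial, h.1⟩, h.2⟩
    rw [← hB, ← hw] at hcore
    simp only [prod_const, card_univ, Fintype.card_fin] at hcore
    have hcoreR : (B : ℝ) * ((((k - w : ℕ) : ℝ) ^ (q + 1)) ^ (r + 1)) ≤
        (3 * ((r + 1 : ℝ) * (q + 1))) ^ w * copyCount (expandedK (r + 1) (q + 1)) H := by
      exact_mod_cast hcore
    have hk2 := half_le_natCast_sub hk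
    -- For the count itself `#U ≤ n` suffices; the size of `U` matters only in the sparse
    -- alternative.
    have h1 : (((#P : ℝ) / 2) ^ (r + 1) / (n ^ r) / 2) ^ (q + 1) / (n ^ (r + 1)) ^ q ≤ B := by
      refine le_trans ?_ key
      gcongr
    have h2 : (((#P : ℝ) / 2) ^ (r + 1) / (n ^ r) / 2) ^ (q + 1) / (n ^ (r + 1)) ^ q *
        ((((k : ℝ) / 2) ^ (q + 1)) ^ (r + 1)) ≤
        (3 * ((r + 1 : ℝ) * (q + 1))) ^ w * copyCount (expandedK (r + 1) (q + 1)) H := by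
      refine le_trans ?_ hcoreR
      gcongr
    have h3 : θ ^ ((r + 1) * (q + 1)) ≤ ((#P : ℝ) * k) ^ ((r + 1) * (q + 1)) :=
      pow_le_pow_left₀ hθ0 hθ _
    have h4 : ((#P : ℝ) * k) ^ ((r + 1) * (q + 1)) * n ^ (r + 1 + (q + 1)) =
        (4 ^ ((r + 1) * (q + 1)) * 2 ^ (q + 1)) *
        ((((#P : ℝ) / 2) ^ (r + 1) / (n ^ r) / 2) ^ (q + 1) / (n ^ (r + 1)) ^ q *
        ((((k : ℝ) / 2) ^ (q + 1)) ^ (r + 1))) * n ^ (2 * ((r + 1) * (q + 1))) := by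
      have h5 : n ^ (2 * ((r + 1) * (q + 1))) =
          n ^ (r + 1 + (q + 1)) * ((n ^ r) ^ (q + 1) * (n ^ (r + 1)) ^ q) := by
        rw [← pow_mul, ← pow_mul, ← pow_add, ← pow_add]
        congr 1
        ring
      have h6 : (4 : ℝ) ^ ((r + 1) * (q + 1)) =
          (2 ^ (r + 1)) ^ (q + 1) * (2 ^ (q + 1)) ^ (r + 1) := by
        rw [← pow_mul, ← pow_mul, mul_comm (q + 1) (r + 1), ← mul_pow]
        norm_num
      rw [h5, h6, mul_pow, pow_mul, pow_mul', div_pow, div_pow, div_pow, div_pow, div_pow, div_pow]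
      field_simp
    calc _ ≤ ((#P : ℝ) * k) ^ ((r + 1) * (q + 1)) * n ^ (r + 1 + (q + 1)) := by gcongr
      _ = _ := h4
      _ ≤ (4 ^ ((r + 1) * (q + 1)) * 2 ^ (q + 1)) *
        ((3 * ((r + 1 : ℝ) * (q + 1))) ^ w * copyCount (expandedK (r + 1) (q + 1)) H) *
          n ^ (2 * ((r + 1) * (q + 1))) := by gcongr
      _ = _ := by ring
  · have : #{p : Unit × V | ∃ x, (p.2, x) ∈ P} ≤ #U := by
      refine card_le_card_of_injOn (fun p => p.2) ?_ ?_
      · intro p hp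
        simp only [coe_filter, mem_univ, true_and, Set.mem_ofPred_eq] at hp
        obtain ⟨x, hx⟩ := hp
        exact (hP _ hx).1
      · rintro ⟨⟨⟩, y⟩ _ ⟨⟨⟩, y'⟩ _ h
        exact congrArg _ h
    exact_mod_cast this
  · rw [hn]
    norm_cast
    refine (card_le_univ _).trans (le_of_eq ?_)
    simp
  · rw [htot]
    refine (lt_of_pow_lt_pow_left₀ (r + 1) (by positivity) (lt_of_le_of_lt ?_ hPr)).le
    calc (2 * (r + 1 : ℝ) * #U) ^ (r + 1) = (2 * (r + 1 : ℝ)) ^ (r + 1) * (#U : ℝ) ^ r * #U := by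
          rw [mul_pow, pow_succ (#U : ℝ), ← mul_assoc]
      _ ≤ (2 * (r + 1 : ℝ)) ^ (r + 1) * (#U : ℝ) ^ r * n ^ (r + 1) := by
          gcongr
          exact hUn.trans (le_self_pow₀ hn1 (Nat.succ_ne_zero r))
      _ ≤ _ := by
          gcongr
          exact le_add_of_nonneg_right (by positivity)
  · rw [htot, le_div_iff₀ hu0, div_pow, le_div_iff₀ (by positivity)]
    calc _ = 2 * (q + 1 : ℝ) * 2 ^ (r + 1) * (#U : ℝ) ^ r * n ^ (r + 1) := by ring
      _ ≤ ((2 * (r + 1 : ℝ)) ^ (r + 1) + 2 * (q + 1) * 2 ^ (r + 1)) * (#U : ℝ) ^ r *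
          n ^ (r + 1) := by
        gcongr
        exact le_add_of_nonneg_left (by positivity)
      _ ≤ _ := hPr.le

/-- Counting the copies of `K_{s,t}^{(3)}` in which one core vertex `z` of the part of size `s` is
joined to the copy of `K_{s-1,t}` on the other core vertices by edges of the hypergraph. -/
theorem copyCount_expandedK_ge_of_triples (H : RGraph V 3) (k q : ℕ) (T : Finset (V × V × V))
    (a b c D : ℕ) (hT : ∀ x y z, (x, y, z) ∈ T → x ≠ z ∧ a ≤ H.codegree x y ∧
      b ≤ H.codegree z y ∧ c ≤ H.codegree z x ∧ H.pairDegree z ≤ 2 * D)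
    (ha : 2 * (k + 2 + (q + 1) + (k + 2) * (q + 1)) ≤ a)
    (hb : 2 * (k + 2 + (q + 1) + (k + 2) * (q + 1)) ≤ b) (hc : 0 < c) (ν : ℝ)
    (hν : (#(T.image fun p => p.2.2) : ℝ) ≤ ν)
    (h1 : 2 * (k + 1 : ℝ) * (#H.triples / b) ≤ #T)
    (h2 : 2 * (q + 1 : ℝ) * (ν * (2 * D / c) ^ (k + 1)) ≤
      ((#T : ℝ) / 2) ^ (k + 1) / (#H.triples / b) ^ k) :
    (((#T : ℝ) / 2) ^ (k + 1) / (#H.triples / b) ^ k / 2) ^ (q + 1) /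
        (ν * (2 * D / c) ^ (k + 1)) ^ q *
        (((b : ℝ) / 2) ^ (q + 1) * (((a : ℝ) / 2) ^ (q + 1)) ^ (k + 1)) ≤
      (3 * ((k + 2) * (q + 1))) ^ (k + 2 + (q + 1) + (k + 2) * (q + 1)) *
        copyCount (expandedK (k + 2) (q + 1)) H := by
  set w := k + 2 + (q + 1) + (k + 2) * (q + 1) with hw
  have hb0 : (0 : ℝ) < b := by
    have : 0 < b := by omega
    exact_mod_cast this
  have hc0 : (0 : ℝ) < c := by exact_mod_cast hc
  have htot : #{p : (V × V) × V | (p.2, p.1.2, p.1.1) ∈ T} = #T := by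
    refine card_nbij' (fun p => (p.2, p.1.2, p.1.1)) (fun p => ((p.2.2, p.2.1), p.1)) ?_ ?_ ?_ ?_
    · intro p hp; simpa using hp
    · intro p hp; simpa using hp
    · intro p _; rfl
    · intro p _; rfl
  have key := card_bicliques_ge (fun z y x => (x, y, z) ∈ T) k q (#H.triples / b)
    (ν * (2 * D / c) ^ (k + 1)) ?_ ?_ (by rw [htot]; exact h1) (by rw [htot]; exact h2)
  · rw [htot] at key
    set B := #{p : (V × (Fin (k + 1) → V)) × (Fin (q + 1) → V) | Function.Injective p.1.2 ∧
      Function.Injective p.2 ∧ ∀ i j, (p.1.2 i, p.2 j, p.1.1) ∈ T} with hB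
    have hcore := card_mul_prod_le_mul_copyCount_expandedK H (Nat.succ_pos (k + 1))
      (Nat.succ_pos q)
      ((univ.filter fun p : (V × (Fin (k + 1) → V)) × (Fin (q + 1) → V) =>
        Function.Injective p.1.2 ∧ Function.Injective p.2 ∧
          ∀ i j, (p.1.2 i, p.2 j, p.1.1) ∈ T).image
        -- The link vertex `z` becomes core vertex 0. Its pairs with the `y`'s have codegree at
        -- least `b`; all other core pairs have codegree at least `a`.
        fun p => (Fin.cons (α := fun _ => V) p.1.1 p.1.2, p.2))
      (fun i _ => Fin.cons (α := fun _ => ℕ) b (fun _ => a) i)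
      (fun i _ => by
        refine Fin.cases ?_ (fun i => ?_) i
        · simp only [Fin.cons_zero]; omega
        · simp only [Fin.cons_succ]; omega) (by
        intro c hc
        obtain ⟨p, hp, rfl⟩ := mem_image.1 hc
        simp only [mem_filter, mem_univ, true_and] at hp
        refine ⟨?_, hp.2.1, fun i j => ?_⟩
        · rw [Fin.cons_injective_iff]
          refine ⟨?_, hp.1⟩
          rintro ⟨i, hi⟩
          exact (hT _ _ _ (hp.2.2 i 0)).1 hi
        · refine Fin.cases ?_ (fun i => ?_) i
          · simp only [Fin.cons_zero]
            exact (hT _ _ _ (hp.2.2 0 j)).2.2.1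
          · simp only [Fin.cons_succ]
            exact (hT _ _ _ (hp.2.2 i j)).2.1)
    rw [card_image_of_injective] at hcore
    swap
    · rintro ⟨⟨z, y⟩, x⟩ ⟨⟨z', y'⟩, x'⟩ h
      simp only [Prod.mk.injEq, Fin.cons_inj] at h ⊢
      exact h
    rw [← hB] at hcore
    rw [Fin.prod_univ_succ] at hcore
    simp only [Fin.cons_zero, Fin.cons_succ, prod_const, card_univ, Fintype.card_fin] at hcore
    have hcoreR : (B : ℝ) * ((((b - w : ℕ) : ℝ) ^ (q + 1)) *
        (((a - w : ℕ) : ℝ) ^ (q + 1)) ^ (k + 1)) ≤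
        (3 * ((k + 2 : ℝ) * (q + 1))) ^ w * copyCount (expandedK (k + 2) (q + 1)) H := by
      exact_mod_cast hcore
    have ha2 := half_le_natCast_sub ha
    have hb2 := half_le_natCast_sub hb
    refine le_trans ?_ hcoreR
    gcongr
  · rw [le_div_iff₀ hb0]
    have : #{p : V × V | ∃ x, (x, p.2, p.1) ∈ T} * b ≤ #H.triples := by
      refine card_pairs_mul_le_card_triples H _ ?_
      intro p hp
      simp only [mem_filter, mem_univ, true_and] at hp
      obtain ⟨x, hx⟩ := hp
      exact (hT _ _ _ hx).2.2.1
    exact_mod_cast this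
  · have h3 : #{p : V × (Fin (k + 1) → V) | ∃ y, ∀ i, (p.2 i, y, p.1) ∈ T} ≤
        (2 * D / c) ^ (k + 1) * #(T.image fun p => p.2.2) := by
      refine le_trans (card_le_mul_card_image (f := Prod.fst) _ ((2 * D / c) ^ (k + 1)) ?_)
        (Nat.mul_le_mul_left _ (card_le_card ?_))
      · intro z hz
        obtain ⟨⟨z, f⟩, hf, rfl⟩ := mem_image.1 hz
        simp only [mem_filter, mem_univ, true_and] at hf
        obtain ⟨y, hy⟩ := hf
        let X : Finset V := {x | c ≤ H.codegree z x}
        -- The entries of a leaf tuple for `z` have codegree at least `c` with `z`, and these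
        -- codegrees sum to at most `2 * D`.
        have hX : #X ≤ 2 * D / c := by
          rw [Nat.le_div_iff_mul_le hc]
          exact (card_mul_le_pairDegree H z X (by simp [X])).trans (hT _ _ _ (hy 0)).2.2.2.2
        calc _ ≤ #(({z} : Finset V) ×ˢ Fintype.piFinset fun _ : Fin (k + 1) => X) := by
              refine card_le_card ?_
              intro p hp
              simp only [mem_filter, mem_univ, true_and] at hp
              obtain ⟨⟨y', hy'⟩, hz⟩ := hp
              simp only [mem_product, mem_singleton, Fintype.mem_piFinset]
              refine ⟨hz, fun i => ?_⟩
              simp only [X, mem_filter, mem_univ, true_and]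
              have := (hT _ _ _ (hy' i)).2.2.2.1
              rwa [hz] at this
          _ ≤ _ := by
              simp only [card_product, card_singleton, Fintype.card_piFinset, prod_const,
                card_univ, Fintype.card_fin, one_mul]
              exact Nat.pow_le_pow_left hX _
      · intro z hz
        obtain ⟨p, hp, rfl⟩ := mem_image.1 hz
        simp only [mem_filter, mem_univ, true_and] at hp
        obtain ⟨y, hy⟩ := hp
        exact mem_image.2 ⟨_, hy 0, rfl⟩
    have h4 : ((2 * D / c : ℕ) : ℝ) ≤ 2 * D / c := by
      refine Nat.cast_div_le.trans (le_of_eq ?_)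
      push_cast
      rfl
    calc _ ≤ (((2 * D / c) ^ (k + 1) * #(T.image fun p => p.2.2) : ℕ) : ℝ) := by exact_mod_cast h3
      _ = ((2 * D / c : ℕ) : ℝ) ^ (k + 1) * #(T.image fun p => p.2.2) := by push_cast; rfl
      _ ≤ (2 * D / c) ^ (k + 1) * ν := by gcongr
      _ = _ := mul_comm _ _

end RGraph

/-! ### Numerical estimates in the sparse case -/

/-- The numerical estimates behind the count of copies of `K_{s,t}^{(3)}`, with `s = k + 2`,
`t = q + 1`, for a hypergraph on `η ^ s` vertices. -/
theorem supersaturation_estimate (k q : ℕ) {θ τ a b c D η ρ G : ℝ} (hθ : 0 < θ) (hτ : 0 < τ)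
    (ha : 0 < a) (hb : 0 < b) (hc : 0 < c) (hD : 0 < D) (hρ : 1 ≤ ρ) (hρη : ρ ≤ η)
    (hG : 2 ≤ G) (hτθ : τ ≤ G * θ) (hDρ : D * ρ ^ (k + 2) ≤ G * θ)
    (hθa : θ ≤ G * a * η ^ (2 * k + 3)) (hθb : θ ≤ G * b * (ρ ^ (k + 1) * η ^ (k + 2)))
    (hθc : θ ≤ G * c * (ρ ^ (k + 1) * η ^ (k + 2))) (hGq : 2 * (q + 1 : ℝ) ≤ G)
    {μ : ℝ} (hμ : θ = μ * η ^ (3 * k + 3)) (hμG : G ^ (5 * k + 4) ≤ μ)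
    (hμη : η ≤ μ ^ (q + 1)) :
    2 * (q + 1 : ℝ) * (ρ ^ (k + 2) * (2 * D / c) ^ (k + 1)) ≤ θ ^ (k + 1) / (τ / b) ^ k ∧
    θ ^ ((k + 2) * (q + 1)) * (η ^ (k + 2)) ^ (k + 2 + (q + 1)) ≤
      G ^ (2 * k + 2 * (q + 1) + 2 * ((q + 1) * (k + 1)) + (5 * k + 3) * q + (q + 1)) *
      ((θ ^ (k + 1) / (τ / b) ^ k / 2) ^ (q + 1) / (ρ ^ (k + 2) * (2 * D / c) ^ (k + 1)) ^ q *
        ((b / 2) ^ (q + 1) * ((a / 2) ^ (q + 1)) ^ (k + 1))) *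
      (η ^ (k + 2)) ^ (2 * ((k + 2) * (q + 1))) := by
  have hG0 : 0 < G := by linarith
  have hG1 : 1 ≤ G := by linarith
  have hρ0 : 0 < ρ := by linarith
  have hη0 : 0 < η := by linarith
  have hμ1 : 1 ≤ μ := (one_le_pow₀ hG1).trans hμG
  have hμ0 : 0 < μ := by linarith
  obtain ⟨S, hS⟩ : ∃ S, S = θ ^ (k + 1) / (τ / b) ^ k := ⟨_, rfl⟩
  obtain ⟨Q, hQ⟩ : ∃ Q, Q = ρ ^ (k + 2) * (2 * D / c) ^ (k + 1) := ⟨_, rfl⟩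
  rw [← hS, ← hQ]
  have hS0 : 0 < S := by rw [hS]; positivity
  have hQ0 : 0 < Q := by rw [hQ]; positivity
  have hQle : Q ≤ ρ * (G ^ (3 * (k + 1)) * η ^ ((k + 2) * (k + 1))) := by
    -- The degree bound `hDρ` and sparseness of the pairs `zx` together bound the relevant
    -- neighbourhood of `z` by $n/|Z|^{1/s}$ up to powers of $G$, with $ρ=|Z|^{1/s}$.
    have h1 : D * ρ ≤ G * G * c * η ^ (k + 2) := by
      have h2 : D * ρ * ρ ^ (k + 1) ≤ G * G * c * η ^ (k + 2) * ρ ^ (k + 1) :=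
        calc D * ρ * ρ ^ (k + 1) = D * ρ ^ (k + 2) := by ring
          _ ≤ G * θ := hDρ
          _ ≤ G * (G * c * (ρ ^ (k + 1) * η ^ (k + 2))) := by gcongr
          _ = _ := by ring
      exact le_of_mul_le_mul_right h2 (by positivity)
    have h3 : 2 * D / c ≤ G ^ 3 * η ^ (k + 2) / ρ := by
      rw [div_le_div_iff₀ hc hρ0]
      calc 2 * D * ρ = 2 * (D * ρ) := by ring
        _ ≤ G * (G * G * c * η ^ (k + 2)) := by gcongr
        _ = _ := by ring
    calc Q ≤ ρ ^ (k + 2) * (G ^ 3 * η ^ (k + 2) / ρ) ^ (k + 1) := by rw [hQ]; gcongr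
      _ = _ := by
        rw [div_pow, mul_pow, ← pow_mul, ← pow_mul]
        field_simp
        ring
  have hSge : θ * b ^ k ≤ G ^ k * S := by
    rw [hS, div_pow, div_div_eq_mul_div, mul_div_assoc', le_div_iff₀ (by positivity)]
    calc θ * b ^ k * τ ^ k ≤ θ * b ^ k * (G * θ) ^ k := by gcongr
      _ = _ := by rw [mul_pow]; ring
  -- Stars outnumber leaf tuples by $μ^{k+1}$ up to powers of $G$. After sparseness of the pairs
  -- `zy` is inserted, `ρ` enters with positive exponent, so the worst case is `ρ = η`.
  have hR : Q * μ ^ (k + 1) ≤ G ^ (5 * k + 3) * S := by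
    have h1 : θ ^ k ≤ b ^ k * (G ^ k * (ρ ^ (k + 1) * η ^ (k + 2)) ^ k) := by
      calc θ ^ k ≤ (G * b * (ρ ^ (k + 1) * η ^ (k + 2))) ^ k := by gcongr
        _ = _ := by rw [mul_pow, mul_pow]; ring
    have h2 : Q * μ ^ (k + 1) * (G ^ k * (ρ ^ (k + 1) * η ^ (k + 2)) ^ k) ≤
        G ^ (4 * k + 3) * θ * b ^ k * (G ^ k * (ρ ^ (k + 1) * η ^ (k + 2)) ^ k) := by
      calc Q * μ ^ (k + 1) * (G ^ k * (ρ ^ (k + 1) * η ^ (k + 2)) ^ k)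
          ≤ ρ * (G ^ (3 * (k + 1)) * η ^ ((k + 2) * (k + 1))) * μ ^ (k + 1) *
            (G ^ k * (ρ ^ (k + 1) * η ^ (k + 2)) ^ k) := by gcongr
        _ = G ^ (4 * k + 3) * μ ^ (k + 1) * (ρ ^ (1 + (k + 1) * k) *
            (η ^ ((k + 2) * (k + 1)) * η ^ ((k + 2) * k))) := by
          rw [mul_pow, ← pow_mul, ← pow_mul, show 4 * k + 3 = 3 * (k + 1) + k by ring]
          ring
        _ ≤ G ^ (4 * k + 3) * μ ^ (k + 1) * (η ^ (1 + (k + 1) * k) *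
            (η ^ ((k + 2) * (k + 1)) * η ^ ((k + 2) * k))) := by gcongr
        _ = G ^ (4 * k + 3) * θ ^ (k + 1) := by
          rw [hμ, mul_pow, ← pow_add, ← pow_add, ← pow_mul, mul_assoc]
          congr 3
          ring
        _ = G ^ (4 * k + 3) * θ * θ ^ k := by ring
        _ ≤ G ^ (4 * k + 3) * θ * (b ^ k * (G ^ k * (ρ ^ (k + 1) * η ^ (k + 2)) ^ k)) := by gcongr
        _ = _ := by ring
    have h3 := le_of_mul_le_mul_right h2 (by positivity)
    calc _ ≤ G ^ (4 * k + 3) * θ * b ^ k := h3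
      _ = G ^ (4 * k + 3) * (θ * b ^ k) := by ring
      _ ≤ G ^ (4 * k + 3) * (G ^ k * S) := by gcongr
      _ = _ := by
        rw [← mul_assoc, ← pow_add]
        congr 2
        ring
  refine ⟨?_, ?_⟩
  · have h1 : G ^ (5 * k + 3) * (G * Q) ≤ G ^ (5 * k + 3) * S := by
      refine le_trans ?_ hR
      calc G ^ (5 * k + 3) * (G * Q) = Q * G ^ (5 * k + 4) := by ring
        _ ≤ Q * μ := by gcongr
        _ ≤ Q * μ ^ (k + 1) := by
          gcongr
          exact le_self_pow₀ hμ1 (Nat.succ_ne_zero k)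
    exact le_trans (by gcongr) (le_of_mul_le_mul_left h1 (by positivity))
  · have hα : μ * η ^ k ≤ G * a := by
      refine le_of_mul_le_mul_right (a := η ^ (2 * k + 3)) ?_ (by positivity)
      refine le_trans (le_of_eq ?_) hθa
      rw [hμ, mul_assoc, ← pow_add]
      congr 2
      ring
    have hβ : μ * η ^ k ≤ G * b := by
      refine le_of_mul_le_mul_right (a := η ^ (k + 1) * η ^ (k + 2)) ?_ (by positivity)
      calc μ * η ^ k * (η ^ (k + 1) * η ^ (k + 2)) = θ := by
            rw [hμ, mul_assoc, ← pow_add, ← pow_add]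
            congr 2
            ring
        _ ≤ G * b * (ρ ^ (k + 1) * η ^ (k + 2)) := hθb
        _ ≤ _ := by gcongr
    have hα2 : μ * η ^ k ≤ G ^ 2 * (a / 2) := by nlinarith [mul_pos hG0 ha]
    have hβ2 : μ * η ^ k ≤ G ^ 2 * (b / 2) := by nlinarith [mul_pos hG0 hb]
    have hα0 : 0 < μ * η ^ k := by positivity
    have h1 : θ * (μ * η ^ k) ^ k ≤ G ^ (2 * k) * S := by
      calc θ * (μ * η ^ k) ^ k ≤ θ * (G * b) ^ k := by gcongr
        _ = G ^ k * (θ * b ^ k) := by rw [mul_pow]; ring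
        _ ≤ G ^ k * (G ^ k * S) := by gcongr
        _ = _ := by ring
    have h2 : S * μ ^ ((k + 1) * q) ≤
        G ^ ((5 * k + 3) * q + (q + 1)) * ((S / 2) ^ (q + 1) / Q ^ q) := by
      rw [mul_div_assoc', le_div_iff₀ (by positivity)]
      calc S * μ ^ ((k + 1) * q) * Q ^ q = S * (Q * μ ^ (k + 1)) ^ q := by
            rw [mul_pow, ← pow_mul]; ring
        _ ≤ S * (G ^ (5 * k + 3) * S) ^ q := by gcongr
        _ = G ^ ((5 * k + 3) * q) * 2 ^ (q + 1) * (S / 2) ^ (q + 1) := by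
          rw [mul_pow, ← pow_mul, div_pow]
          field_simp
          ring
        _ ≤ G ^ ((5 * k + 3) * q) * G ^ (q + 1) * (S / 2) ^ (q + 1) := by gcongr
        _ = _ := by ring
    have h3 : θ ^ ((k + 2) * (q + 1)) * (η ^ (k + 2)) ^ (k + 2 + (q + 1)) ≤
        θ * (μ * η ^ k) ^ k * μ ^ ((k + 1) * q) * ((μ * η ^ k) ^ (q + 1) *
          ((μ * η ^ k) ^ (q + 1)) ^ (k + 1)) * (η ^ (k + 2)) ^ (2 * ((k + 2) * (q + 1))) := by
      -- The only use of `hμη`: the surplus $μ^{(q+1)(k+1)}$ pays for the missing $η^{k+1}$.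
      have h4 : η ^ (k + 1) ≤ (μ ^ (q + 1)) ^ (k + 1) := by gcongr
      calc θ ^ ((k + 2) * (q + 1)) * (η ^ (k + 2)) ^ (k + 2 + (q + 1))
          = μ ^ ((k + 2) * (q + 1)) * (η ^ ((3 * k + 3) * ((k + 2) * (q + 1))) *
              η ^ ((k + 2) * (k + 2 + (q + 1)))) := by
            rw [hμ, mul_pow, ← pow_mul, ← pow_mul]; ring
        _ = μ ^ ((k + 2) * (q + 1)) * η ^ ((3 * k + 3) + k * k + k * (q + 1) +
              k * ((q + 1) * (k + 1)) + (k + 2) * (2 * ((k + 2) * (q + 1)))) * η ^ (k + 1) := by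
            rw [mul_assoc, ← pow_add, ← pow_add]
            congr 2
            ring
        _ ≤ μ ^ ((k + 2) * (q + 1)) * η ^ ((3 * k + 3) + k * k + k * (q + 1) +
              k * ((q + 1) * (k + 1)) + (k + 2) * (2 * ((k + 2) * (q + 1)))) *
              (μ ^ (q + 1)) ^ (k + 1) := by gcongr
        _ = _ := by
            rw [hμ]
            simp only [mul_pow, ← pow_mul]
            have h5 : μ ^ ((k + 2) * (q + 1)) * μ ^ ((q + 1) * (k + 1)) =
                μ * μ ^ k * μ ^ ((k + 1) * q) * (μ ^ (q + 1) * μ ^ ((q + 1) * (k + 1))) := by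
              rw [← pow_succ', ← pow_add, ← pow_add, ← pow_add, ← pow_add]
              congr 1
              ring
            simp only [pow_add η]
            linear_combination (η ^ (3 * k) * η ^ 3 * η ^ (k * k) * η ^ (k * (q + 1)) *
              η ^ (k * ((q + 1) * (k + 1))) * η ^ ((k + 2) * (2 * ((k + 2) * (q + 1))))) * h5
    refine h3.trans ?_
    refine mul_le_mul_of_nonneg_right ?_ (by positivity)
    calc θ * (μ * η ^ k) ^ k * μ ^ ((k + 1) * q) * ((μ * η ^ k) ^ (q + 1) *
          ((μ * η ^ k) ^ (q + 1)) ^ (k + 1))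
        ≤ G ^ (2 * k) * S * μ ^ ((k + 1) * q) * ((G ^ 2 * (b / 2)) ^ (q + 1) *
          ((G ^ 2 * (a / 2)) ^ (q + 1)) ^ (k + 1)) := by gcongr
      _ = G ^ (2 * k + 2 * (q + 1) + 2 * ((q + 1) * (k + 1))) * (S * μ ^ ((k + 1) * q)) *
          ((b / 2) ^ (q + 1) * ((a / 2) ^ (q + 1)) ^ (k + 1)) := by
          simp only [mul_pow, ← pow_mul, pow_add]
          ring
      _ ≤ G ^ (2 * k + 2 * (q + 1) + 2 * ((q + 1) * (k + 1))) *
          (G ^ ((5 * k + 3) * q + (q + 1)) * ((S / 2) ^ (q + 1) / Q ^ q)) *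
          ((b / 2) ^ (q + 1) * ((a / 2) ^ (q + 1)) ^ (k + 1)) := by gcongr
      _ = _ := by
          rw [add_assoc _ ((5 * k + 3) * q) (q + 1),
            pow_add G (2 * k + 2 * (q + 1) + 2 * ((q + 1) * (k + 1)))]
          ring

/-! ### Regularisation of codegrees and degrees -/

namespace RGraph

theorem triple_rotations {V : Type*} [DecidableEq V] (H : RGraph V 3) {x y z : V}
    (h : ({x, y, z} : Finset V) ∈ H.edges) :
    ({z, y, x} : Finset V) ∈ H.edges ∧ ({z, x, y} : Finset V) ∈ H.edges := by
  have h1 : ({x, y, z} : Finset V) = {z, y, x} := by ext; simp; tauto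
  have h2 : ({x, y, z} : Finset V) = {z, x, y} := by ext; simp; tauto
  exact ⟨h1 ▸ h, h2 ▸ h⟩

variable {V : Type*} [Fintype V] [DecidableEq V]

/-- `π` selects two vertices of a triple and `κ` the third, so `κ` embeds each fibre of `π` into the
vertices completing the pair. The abstract form serves the three kinds of pairs at once. -/
theorem card_le_mul_card_image_pairs (H : RGraph V 3) {S : Finset (V × V × V)}
    (hS : S ⊆ H.triples) (π : V × V × V → V × V) (κ : V × V × V → V)
    (hinj : Function.Injective fun p => (π p, κ p))
    (hmem : ∀ p ∈ H.triples, ({(π p).1, (π p).2, κ p} : Finset V) ∈ H.edges) {B : ℕ}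
    (hB : ∀ p ∈ S, H.codegree (π p).1 (π p).2 ≤ B) : #S ≤ B * #(S.image π) := by
  refine card_le_mul_card_image S B fun a ha => ?_
  obtain ⟨p₀, hp₀, rfl⟩ := mem_image.1 ha
  refine le_trans (card_le_card_of_injOn κ ?_ ?_) (hB p₀ hp₀)
  · intro p hp
    simp only [coe_filter, Set.mem_ofPred_eq] at hp
    have := hmem p (hS hp.1)
    rw [hp.2] at this
    simpa using this
  · intro p hp p' hp' h
    simp only [coe_filter, Set.mem_ofPred_eq] at hp hp'
    exact hinj (Prod.ext (hp.2.trans hp'.2.symm) h)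

/-- At most $n^2$ pairs carry few triples each. The constant 6 lets the three kinds of pairs
together lose at most half of all triples. -/
theorem six_mul_card_low_codegree_le (H : RGraph V 3) (π : V × V × V → V × V)
    (κ : V × V × V → V) (hinj : Function.Injective fun p => (π p, κ p))
    (hmem : ∀ p ∈ H.triples, ({(π p).1, (π p).2, κ p} : Finset V) ∈ H.edges) :
    6 * #{p ∈ H.triples | ¬ #H.triples ≤ 6 * Fintype.card V ^ 2 * H.codegree (π p).1 (π p).2} ≤
      #H.triples := by
  set S := {p ∈ H.triples |
    ¬ #H.triples ≤ 6 * Fintype.card V ^ 2 * H.codegree (π p).1 (π p).2} with hSdef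
  rcases Nat.eq_zero_or_pos (Fintype.card V) with h0 | h0
  · have : IsEmpty V := Fintype.card_eq_zero_iff.1 h0
    simp [Finset.eq_empty_of_isEmpty S]
  have hpos : 0 < 6 * Fintype.card V ^ 2 := by positivity
  have h1 : #S ≤ #H.triples / (6 * Fintype.card V ^ 2) * #(S.image π) := by
    refine card_le_mul_card_image_pairs H (filter_subset _ _) π κ hinj hmem fun p hp => ?_
    rw [Nat.le_div_iff_mul_le hpos, mul_comm]
    exact (not_le.1 (mem_filter.1 hp).2).le
  have h2 : #(S.image π) ≤ Fintype.card V ^ 2 := by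
    refine (card_le_univ _).trans ?_
    rw [Fintype.card_prod, sq]
  calc 6 * #S ≤ 6 * (#H.triples / (6 * Fintype.card V ^ 2) * Fintype.card V ^ 2) :=
        Nat.mul_le_mul_left _ (h1.trans (Nat.mul_le_mul_left _ h2))
    _ = #H.triples / (6 * Fintype.card V ^ 2) * (6 * Fintype.card V ^ 2) := by ring
    _ ≤ _ := Nat.div_mul_le_self _ _

theorem codegree_le (H : RGraph V 3) (x y : V) : H.codegree x y ≤ Fintype.card V :=
  card_le_univ _

theorem pairDegree_le (H : RGraph V 3) (z : V) : H.pairDegree z ≤ Fintype.card V ^ 2 := by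
  rw [sq, ← smul_eq_mul, ← card_univ]
  exact sum_le_card_nsmul _ _ _ fun x _ => H.codegree_le z x

/-- Dyadic pigeonholing of the codegrees and of the degree of one vertex. -/
theorem exists_regular_triples (H : RGraph V 3) (hH : 0 < #H.triples) :
    ∃ T ⊆ H.triples, ∃ a b c D : ℕ, 0 < a ∧ 0 < b ∧ 0 < c ∧ 0 < D ∧ T.Nonempty ∧
      (#H.triples : ℝ) ≤ 2 * (Nat.log 2 (Fintype.card V ^ 2) + 1 : ℝ) ^ 4 * #T ∧
      #H.triples ≤ 12 * Fintype.card V ^ 2 * a ∧ #H.triples ≤ 12 * Fintype.card V ^ 2 * b ∧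
      #H.triples ≤ 12 * Fintype.card V ^ 2 * c ∧
      ∀ x y z, (x, y, z) ∈ T →
        (a ≤ H.codegree x y ∧ H.codegree x y ≤ 2 * a) ∧
        (b ≤ H.codegree z y ∧ H.codegree z y ≤ 2 * b) ∧
        (c ≤ H.codegree z x ∧ H.codegree z x ≤ 2 * c) ∧
        (D ≤ H.pairDegree z ∧ H.pairDegree z ≤ 2 * D) := by
  set n := Fintype.card V with hn
  set L := Nat.log 2 (n ^ 2) + 1 with hL
  set T₁ := {p ∈ H.triples | #H.triples ≤ 6 * n ^ 2 * H.codegree p.1 p.2.1 ∧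
    #H.triples ≤ 6 * n ^ 2 * H.codegree p.2.2 p.2.1 ∧
    #H.triples ≤ 6 * n ^ 2 * H.codegree p.2.2 p.1} with hT₁
  have hcard : #H.triples ≤ 2 * #T₁ := by
    have hxy := six_mul_card_low_codegree_le H (fun p => (p.1, p.2.1)) (fun p => p.2.2)
      (by rintro ⟨x, y, z⟩ ⟨x', y', z'⟩ h; simp_all) (fun p hp => H.mem_triples.1 hp)
    have hzy := six_mul_card_low_codegree_le H (fun p => (p.2.2, p.2.1)) (fun p => p.1)
      (by rintro ⟨x, y, z⟩ ⟨x', y', z'⟩ h; simp_all)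
      (fun p hp => (H.triple_rotations (H.mem_triples.1 hp)).1)
    have hzx := six_mul_card_low_codegree_le H (fun p => (p.2.2, p.1)) (fun p => p.2.1)
      (by rintro ⟨x, y, z⟩ ⟨x', y', z'⟩ h; simp_all)
      (fun p hp => (H.triple_rotations (H.mem_triples.1 hp)).2)
    have hsub : H.triples ⊆ T₁ ∪
        ({p ∈ H.triples | ¬ #H.triples ≤ 6 * n ^ 2 * H.codegree p.1 p.2.1} ∪
        ({p ∈ H.triples | ¬ #H.triples ≤ 6 * n ^ 2 * H.codegree p.2.2 p.2.1} ∪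
        {p ∈ H.triples | ¬ #H.triples ≤ 6 * n ^ 2 * H.codegree p.2.2 p.1})) := by
      intro p hp
      simp only [hT₁, mem_union, mem_filter, hp, true_and]
      tauto
    have h1 := card_le_card hsub
    have h2 := card_union_le T₁
      ({p ∈ H.triples | ¬ #H.triples ≤ 6 * n ^ 2 * H.codegree p.1 p.2.1} ∪
        ({p ∈ H.triples | ¬ #H.triples ≤ 6 * n ^ 2 * H.codegree p.2.2 p.2.1} ∪
        {p ∈ H.triples | ¬ #H.triples ≤ 6 * n ^ 2 * H.codegree p.2.2 p.1}))
    have h3 := card_union_le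
      {p ∈ H.triples | ¬ #H.triples ≤ 6 * n ^ 2 * H.codegree p.1 p.2.1}
        ({p ∈ H.triples | ¬ #H.triples ≤ 6 * n ^ 2 * H.codegree p.2.2 p.2.1} ∪
        {p ∈ H.triples | ¬ #H.triples ≤ 6 * n ^ 2 * H.codegree p.2.2 p.1})
    have h4 := card_union_le
      {p ∈ H.triples | ¬ #H.triples ≤ 6 * n ^ 2 * H.codegree p.2.2 p.2.1}
        {p ∈ H.triples | ¬ #H.triples ≤ 6 * n ^ 2 * H.codegree p.2.2 p.1}
    simp only [← hn] at hxy hzy hzx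
    omega
  -- Four binary scales with at most `L` values each, hence the loss `L ^ 4`. Rounding a codegree
  -- down to a power of 2 turns the 6 above into 12.
  let f : V × V × V → ℕ × ℕ × ℕ × ℕ := fun p =>
    (Nat.log 2 (H.codegree p.1 p.2.1), Nat.log 2 (H.codegree p.2.2 p.2.1),
      Nat.log 2 (H.codegree p.2.2 p.1), Nat.log 2 (H.pairDegree p.2.2))
  have hlog : ∀ v, v ≤ n ^ 2 → Nat.log 2 v < L := fun v hv =>
    Nat.lt_succ_of_le (Nat.log_mono_right hv)
  have hlogc : ∀ x y, Nat.log 2 (H.codegree x y) < L := fun x y =>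
    hlog _ ((H.codegree_le x y).trans (Nat.le_self_pow two_ne_zero n))
  have hmaps : ∀ p ∈ T₁, f p ∈ range L ×ˢ range L ×ˢ range L ×ˢ range L := fun p _ => by
    simp only [f, mem_product, mem_range]
    exact ⟨hlogc _ _, hlogc _ _, hlogc _ _, hlog _ (H.pairDegree_le _)⟩
  have hL0 : 0 < L := Nat.succ_pos _
  obtain ⟨⟨i, j, l, d⟩, -, hfib⟩ := exists_le_card_fiber_of_nsmul_le_card_of_maps_to
    (b := (#T₁ : ℝ) / (L : ℝ) ^ 4) hmaps
    ⟨(0, 0, 0, 0), by simp [hL0]⟩ (by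
      simp only [card_product, card_range, nsmul_eq_mul]
      push_cast
      have : (0 : ℝ) < L := by exact_mod_cast hL0
      rw [mul_div_assoc', div_le_iff₀ (by positivity)]
      exact le_of_eq (by ring))
  set T := {p ∈ T₁ | f p = (i, j, l, d)} with hT
  have hTsub : T ⊆ H.triples := (filter_subset _ _).trans (filter_subset _ _)
  have hLr : (0 : ℝ) < L := by exact_mod_cast hL0
  rw [div_le_iff₀ (by positivity)] at hfib
  have hT₁pos : 0 < #T₁ := by omega
  have hTpos : 0 < #T := by
    by_contra h
    have : #T = 0 := by omega
    rw [this] at hfib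
    have : (0 : ℝ) < #T₁ := by exact_mod_cast hT₁pos
    simp only [Nat.cast_zero, zero_mul] at hfib
    linarith
  have hpow : ∀ {v e : ℕ}, 0 < v → Nat.log 2 v = e → 2 ^ e ≤ v ∧ v ≤ 2 * 2 ^ e := by
    rintro v e hv rfl
    refine ⟨Nat.pow_log_le_self 2 hv.ne', ?_⟩
    have := Nat.lt_pow_succ_log_self one_lt_two v
    rw [pow_succ] at this
    omega
  have hfacts : ∀ x y z, (x, y, z) ∈ T →
        (2 ^ i ≤ H.codegree x y ∧ H.codegree x y ≤ 2 * 2 ^ i) ∧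
        (2 ^ j ≤ H.codegree z y ∧ H.codegree z y ≤ 2 * 2 ^ j) ∧
        (2 ^ l ≤ H.codegree z x ∧ H.codegree z x ≤ 2 * 2 ^ l) ∧
        (2 ^ d ≤ H.pairDegree z ∧ H.pairDegree z ≤ 2 * 2 ^ d) := by
    intro x y z hp
    have hE := H.mem_triples.1 (hTsub hp)
    have hf := (mem_filter.1 hp).2
    simp only [f, Prod.mk.injEq] at hf
    have h1 : 0 < H.codegree x y := card_pos.2 ⟨z, by simpa using hE⟩
    have h2 : 0 < H.codegree z y := card_pos.2 ⟨x, by simpa using (H.triple_rotations hE).1⟩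
    have h3 : 0 < H.codegree z x := card_pos.2 ⟨y, by simpa using (H.triple_rotations hE).2⟩
    have h4 : 0 < H.pairDegree z :=
      h3.trans_le (single_le_sum (f := fun x => H.codegree z x) (fun _ _ => Nat.zero_le _)
        (mem_univ x))
    exact ⟨hpow h1 hf.1, hpow h2 hf.2.1, hpow h3 hf.2.2.1, hpow h4 hf.2.2.2⟩
  obtain ⟨⟨x₀, y₀, z₀⟩, h₀⟩ := card_pos.1 hTpos
  have h₀f := hfacts _ _ _ h₀
  have h₀' := (mem_filter.1 (mem_filter.1 h₀).1).2
  refine ⟨T, hTsub, 2 ^ i, 2 ^ j, 2 ^ l, 2 ^ d, by positivity, by positivity, by positivity,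
    by positivity, ⟨_, h₀⟩, ?_, ?_, ?_, ?_, hfacts⟩
  · have : (#H.triples : ℝ) ≤ 2 * #T₁ := by exact_mod_cast hcard
    have hLc : (L : ℝ) = Nat.log 2 (n ^ 2) + 1 := by rw [hL]; push_cast; rfl
    rw [← hLc]
    linarith
  · refine h₀'.1.trans ?_
    calc 6 * n ^ 2 * H.codegree x₀ y₀ ≤ 6 * n ^ 2 * (2 * 2 ^ i) :=
          Nat.mul_le_mul_left _ h₀f.1.2
      _ = _ := by ring
  · refine h₀'.2.1.trans ?_
    calc 6 * n ^ 2 * H.codegree z₀ y₀ ≤ 6 * n ^ 2 * (2 * 2 ^ j) :=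
          Nat.mul_le_mul_left _ h₀f.2.1.2
      _ = _ := by ring
  · refine h₀'.2.2.trans ?_
    calc 6 * n ^ 2 * H.codegree z₀ x₀ ≤ 6 * n ^ 2 * (2 * 2 ^ l) :=
          Nat.mul_le_mul_left _ h₀f.2.2.1.2
      _ = _ := by ring

end RGraph

/-! ### The dichotomy between dense pairs and links -/

namespace RGraph

variable {V : Type*} [Fintype V] [DecidableEq V]

/-- Extraction of the `N`-th root of the sparse alternative. Expressing set sizes as `N`-th powers
keeps all exponents natural. -/
theorem le_of_pow_le_sparse {N : ℕ} {θ C G b x y : ℝ} {r : ℕ} (hN : N = r + 1) (hG : 1 ≤ G)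
    (hC : C ≤ G) (hb : 0 ≤ b) (hx : 0 ≤ x) (hy : 0 ≤ y)
    (h : θ ^ N ≤ C * b ^ N * (x ^ N) ^ r * (y ^ N) ^ N) :
    θ ≤ G * b * (x ^ r * y ^ N) := by
  subst hN
  refine le_of_pow_le_pow_left₀ (Nat.succ_ne_zero r) (by positivity) (h.trans ?_)
  have h1 : C ≤ G ^ (r + 1) := hC.trans (le_self_pow₀ hG (Nat.succ_ne_zero r))
  calc C * b ^ (r + 1) * (x ^ (r + 1)) ^ r * (y ^ (r + 1)) ^ (r + 1)
      ≤ G ^ (r + 1) * b ^ (r + 1) * (x ^ (r + 1)) ^ r * (y ^ (r + 1)) ^ (r + 1) := by gcongr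
    _ = _ := by
      rw [mul_pow, mul_pow, mul_pow, ← pow_mul x, ← pow_mul x, mul_comm r (r + 1), mul_assoc _ _ (_ ^ _)]

/-- Supersaturation for `K_{s,t}^{(3)}`, with `s = k + 2` and `t = q + 1`, in terms of the number
of ordered edges and of a parameter `G` dominating the constants and the number of dyadic
classes. -/
theorem copyCount_expandedK_ge (H : RGraph V 3) (k q : ℕ) [Nonempty V] {G η : ℝ}
    (hη0 : 0 ≤ η) (hη : η ^ (k + 2) = Fintype.card V)
    (hGw : 2 * (k + 2 + (q + 1) + (k + 2) * (q + 1) : ℝ) ≤ G)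
    (hGL : 4 * (Nat.log 2 (Fintype.card V ^ 2) + 1 : ℝ) ^ 4 ≤ G)
    (hGC : (2 * (k + 2 : ℝ)) ^ (k + 2) + 2 * (q + 1) * 2 ^ (k + 2) ≤ G)
    (hGK : 4 ^ ((k + 2) * (q + 1)) * 2 ^ (q + 1) * (3 * ((k + 2 : ℝ) * (q + 1))) ^
        (k + 2 + (q + 1) + (k + 2) * (q + 1)) ≤ G)
    (h1 : 12 * G ^ 2 * (Fintype.card V : ℝ) ^ 2 ≤ #H.triples)
    (h2 : G ^ (5 * k + 5) * η ^ (3 * k + 3) ≤ #H.triples)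
    (h3 : η * (G * η ^ (3 * k + 3)) ^ (q + 1) ≤ (#H.triples : ℝ) ^ (q + 1)) :
    (#H.triples : ℝ) ^ ((k + 2) * (q + 1)) * (Fintype.card V : ℝ) ^ (k + 2 + (q + 1)) ≤
      G ^ ((k + 2) * (q + 1) +
        (2 * k + 2 * (q + 1) + 2 * ((q + 1) * (k + 1)) + (5 * k + 3) * q + (q + 1)) + 1) *
        copyCount (expandedK (k + 2) (q + 1)) H *
        (Fintype.card V : ℝ) ^ (2 * ((k + 2) * (q + 1))) := by
  set n : ℝ := (Fintype.card V : ℝ) with hn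
  set τ : ℝ := (#H.triples : ℝ) with hτ
  have hn1 : 1 ≤ n := by
    rw [hn]
    exact_mod_cast Fintype.card_pos
  have hw0 : (0 : ℝ) ≤ (k + 2) * (q + 1) := by positivity
  have hk0 : (0 : ℝ) ≤ k := by positivity
  have hq0 : (0 : ℝ) ≤ q := by positivity
  have hG2 : 2 ≤ G := by linarith
  have hG1 : 1 ≤ G := by linarith
  have hG0 : 0 < G := by linarith
  have hη1 : 1 ≤ η := by
    by_contra h
    have : η ^ (k + 2) < 1 := pow_lt_one₀ hη0 (not_le.1 h) (Nat.succ_ne_zero _)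
    linarith
  have hτ0 : 0 < τ := lt_of_lt_of_le (by positivity) h1
  obtain ⟨T, hTsub, a, b, c, D, ha, hb, hc, hD, hTne, hTτ, haτ, hbτ, hcτ, hfacts⟩ :=
    exists_regular_triples H (by rw [hτ] at hτ0; exact_mod_cast hτ0)
  have haR : (0 : ℝ) < a := by exact_mod_cast ha
  have hbR : (0 : ℝ) < b := by exact_mod_cast hb
  have hcR : (0 : ℝ) < c := by exact_mod_cast hc
  have hDR : (0 : ℝ) < D := by exact_mod_cast hD
  set θ : ℝ := (#T : ℝ) / 2 with hθ
  have hθ0 : 0 < θ := by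
    have : (0 : ℝ) < #T := by exact_mod_cast hTne.card_pos
    positivity
  have hτθ : τ ≤ G * θ := by
    calc τ ≤ 4 * (Nat.log 2 (Fintype.card V ^ 2) + 1 : ℝ) ^ 4 * θ := by
          rw [hθ]; linarith
      _ ≤ _ := by gcongr
  -- Large codegrees leave room for the greedy extension and make the pairs `zy` few compared with
  -- `T`.
  have hlarge : ∀ e : ℕ, #H.triples ≤ 12 * Fintype.card V ^ 2 * e → G ^ 2 ≤ (e : ℝ) := by
    intro e he
    have h4 : τ ≤ 12 * n ^ 2 * e := by rw [hτ, hn]; exact_mod_cast he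
    have h5 : 12 * n ^ 2 * G ^ 2 ≤ 12 * n ^ 2 * e := by linarith
    exact le_of_mul_le_mul_left h5 (by positivity)
  have haG := hlarge a haτ
  have hbG := hlarge b hbτ
  have hcG := hlarge c hcτ
  have hGG : G ≤ G ^ 2 := le_self_pow₀ hG1 two_ne_zero
  have hwnat : ∀ e : ℕ, G ^ 2 ≤ (e : ℝ) →
      2 * (k + 2 + (q + 1) + (k + 2) * (q + 1)) ≤ e := by
    intro e he
    have h4 : (2 * (k + 2 + (q + 1) + (k + 2) * (q + 1)) : ℝ) ≤ e := by linarith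
    exact_mod_cast h4
  by_contra hgoal
  rw [not_le] at hgoal
  -- If the conclusion fails, so does every bound of the expected order in terms of `θ`. This rules
  -- out the dense alternative for each kind of pair, and finally contradicts the count through
  -- links.
  have hgoal' : ∀ X : ℝ, X ≤ G * copyCount (expandedK (k + 2) (q + 1)) H →
      ∀ j ≤ 2 * k + 2 * (q + 1) + 2 * ((q + 1) * (k + 1)) + (5 * k + 3) * q + (q + 1),
      ¬ θ ^ ((k + 2) * (q + 1)) * n ^ (k + 2 + (q + 1)) ≤
        G ^ j * X * n ^ (2 * ((k + 2) * (q + 1))) := by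
    intro X hX j hj h
    refine absurd hgoal (not_lt.2 ?_)
    calc τ ^ ((k + 2) * (q + 1)) * n ^ (k + 2 + (q + 1))
        ≤ (G * θ) ^ ((k + 2) * (q + 1)) * n ^ (k + 2 + (q + 1)) := by gcongr
      _ = G ^ ((k + 2) * (q + 1)) * (θ ^ ((k + 2) * (q + 1)) * n ^ (k + 2 + (q + 1))) := by
        rw [mul_pow]; ring
      _ ≤ G ^ ((k + 2) * (q + 1)) * (G ^ j * X * n ^ (2 * ((k + 2) * (q + 1)))) := by gcongr
      _ ≤ G ^ ((k + 2) * (q + 1)) * (G ^ j * (G * copyCount (expandedK (k + 2) (q + 1)) H) *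
          n ^ (2 * ((k + 2) * (q + 1)))) := by gcongr
      _ ≤ G ^ ((k + 2) * (q + 1)) * (G ^ (2 * k + 2 * (q + 1) + 2 * ((q + 1) * (k + 1)) +
          (5 * k + 3) * q + (q + 1)) * (G * copyCount (expandedK (k + 2) (q + 1)) H) *
          n ^ (2 * ((k + 2) * (q + 1)))) := by gcongr
      _ = _ := by
        rw [pow_succ, pow_add G ((k + 2) * (q + 1))]
        ring
  have hsparse : ∀ (π : V × V × V → V × V) (κ : V × V × V → V),
      (Function.Injective fun p => (π p, κ p)) →
      (∀ p ∈ H.triples, ({(π p).1, (π p).2, κ p} : Finset V) ∈ H.edges) → ∀ (U : Finset V)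
      (e : ℕ), G ^ 2 ≤ (e : ℝ) → (∀ p ∈ T, (π p).1 ∈ U ∧
        e ≤ H.codegree (π p).1 (π p).2 ∧ H.codegree (π p).1 (π p).2 ≤ 2 * e) →
      ∀ x : ℝ, 0 ≤ x → (#U : ℝ) ≤ x ^ (k + 2) → θ ≤ G * e * (x ^ (k + 1) * η ^ (k + 2)) := by
    intro π κ hinj hmem U e he hU x hx hUx
    have h4 := card_le_mul_card_image_pairs H hTsub π κ hinj hmem fun p hp => (hU p hp).2.2
    have h5 : (#T : ℝ) ≤ 2 * e * #(T.image π) := by exact_mod_cast h4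
    have h6 : θ ≤ #(T.image π) * e := by
      rw [hθ]
      linarith
    rcases copyCount_expandedK_ge_of_pairs H (k + 1) q (T.image π) U e (by
      intro p hp
      obtain ⟨p', hp', rfl⟩ := mem_image.1 hp
      exact ⟨(hU p' hp').1, (hU p' hp').2.1⟩) (hwnat e he) θ hθ0.le h6 with h7 | h7
    · refine absurd h7 ?_
      have h8 := hgoal' (4 ^ ((k + 2) * (q + 1)) * 2 ^ (q + 1) * (3 * ((k + 2 : ℝ) * (q + 1))) ^
        (k + 2 + (q + 1) + (k + 2) * (q + 1)) * copyCount (expandedK (k + 2) (q + 1)) H)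
        (by gcongr) 0 (Nat.zero_le _)
      rw [pow_zero, one_mul] at h8
      convert h8 using 7
      push_cast
      ring
    · refine le_of_pow_le_sparse (N := k + 2) (r := k + 1) rfl hG1 hGC (Nat.cast_nonneg e) hx hη0 ?_
      have h8 : (#U : ℝ) ^ (k + 1) ≤ (x ^ (k + 2)) ^ (k + 1) := by gcongr
      rw [hη]
      refine h7.trans ?_
      push_cast
      rw [show (k : ℝ) + 1 + 1 = k + 2 by ring]
      gcongr
  set Z := T.image fun p => p.2.2 with hZ
  have hZ1 : (1 : ℝ) ≤ #Z := by exact_mod_cast (hTne.image _).card_pos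
  obtain ⟨ρ, hρ0, hρ⟩ : ∃ ρ : ℝ, 0 ≤ ρ ∧ ρ ^ (k + 2) = #Z :=
    ⟨(#Z : ℝ) ^ (((k + 2 : ℕ) : ℝ)⁻¹), Real.rpow_nonneg (Nat.cast_nonneg _) _,
      Real.rpow_inv_natCast_pow (Nat.cast_nonneg _) (Nat.succ_ne_zero _)⟩
  have hρ1 : 1 ≤ ρ := by
    by_contra h
    have : ρ ^ (k + 2) < 1 := pow_lt_one₀ hρ0 (not_le.1 h) (Nat.succ_ne_zero _)
    linarith
  have hρη : ρ ≤ η := by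
    refine le_of_pow_le_pow_left₀ (Nat.succ_ne_zero (k + 1)) hη0 ?_
    refine le_trans (le_of_eq hρ) (le_trans ?_ (le_of_eq hη.symm))
    rw [hn]
    exact_mod_cast card_le_univ Z
  have hθa : θ ≤ G * a * η ^ (2 * k + 3) := by
    have h4 := hsparse (fun p => (p.1, p.2.1)) (fun p => p.2.2)
      (fun p p' h => by simp only [Prod.mk.injEq] at h; exact Prod.ext h.1.1 (Prod.ext h.1.2 h.2)) (fun p hp => H.mem_triples.1 hp) univ a haG
      (fun p hp => ⟨mem_univ _, (hfacts _ _ _ hp).1⟩) η hη0 (by rw [hη, hn]; simp)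
    rw [← pow_add] at h4
    convert h4 using 3
    ring
  -- Pairs containing `z` have their star centres in `Z`, so `ρ` replaces one power of `η` per unit
  -- of exponent; this gain is needed when `Z` is small.
  have hθb := hsparse (fun p => (p.2.2, p.2.1)) (fun p => p.1)
      (fun p p' h => by simp only [Prod.mk.injEq] at h; exact Prod.ext h.2 (Prod.ext h.1.2 h.1.1))
      (fun p hp => (H.triple_rotations (H.mem_triples.1 hp)).1) Z b hbG
      (fun p hp => ⟨mem_image_of_mem _ hp, (hfacts _ _ _ hp).2.1⟩) ρ hρ0 hρ.ge
  have hθc := hsparse (fun p => (p.2.2, p.1)) (fun p => p.2.1)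
      (fun p p' h => by simp only [Prod.mk.injEq] at h; exact Prod.ext h.1.2 (Prod.ext h.2 h.1.1))
      (fun p hp => (H.triple_rotations (H.mem_triples.1 hp)).2) Z c hcG
      (fun p hp => ⟨mem_image_of_mem _ hp, (hfacts _ _ _ hp).2.2.1⟩) ρ hρ0 hρ.ge
  have hDρ : D * ρ ^ (k + 2) ≤ G * θ := by
    have h4 := card_mul_le_card_triples H Z (D := D) (by
      intro z hz
      obtain ⟨p, hp, rfl⟩ := mem_image.1 hz
      exact (hfacts _ _ _ hp).2.2.2.1)
    have h5 : (#Z : ℝ) * D ≤ τ := by rw [hτ]; exact_mod_cast h4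
    rw [hρ]
    linarith
  have hηp : 0 < η ^ (3 * k + 3) := by positivity
  have hμG : G ^ (5 * k + 4) ≤ θ / η ^ (3 * k + 3) := by
    rw [le_div_iff₀ hηp]
    refine le_of_mul_le_mul_left (a := G) ?_ hG0
    calc G * (G ^ (5 * k + 4) * η ^ (3 * k + 3)) = G ^ (5 * k + 5) * η ^ (3 * k + 3) := by ring
      _ ≤ _ := h2.trans hτθ
  have hμη : η ≤ (θ / η ^ (3 * k + 3)) ^ (q + 1) := by
    rw [div_pow, le_div_iff₀ (by positivity)]
    refine le_of_mul_le_mul_left (a := G ^ (q + 1)) ?_ (by positivity)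
    calc G ^ (q + 1) * (η * (η ^ (3 * k + 3)) ^ (q + 1)) = η * (G * η ^ (3 * k + 3)) ^ (q + 1) := by
          rw [mul_pow G]; ring
      _ ≤ τ ^ (q + 1) := h3
      _ ≤ (G * θ) ^ (q + 1) := by gcongr
      _ = _ := mul_pow _ _ _
  have hGq : 2 * (q + 1 : ℝ) ≤ G := by linarith
  obtain ⟨hest1, hest2⟩ := supersaturation_estimate k q hθ0 hτ0 haR hbR hcR hDR hρ1 hρη hG2 hτθ hDρ
    hθa hθb hθc hGq (div_mul_cancel₀ θ hηp.ne').symm hμG hμη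
  have hcount := copyCount_expandedK_ge_of_triples H k q T a b c D
    (fun x y z hp => ⟨(ne_of_triple_mem H (H.mem_triples.1 (hTsub hp))).2.1,
      (hfacts _ _ _ hp).1.1, (hfacts _ _ _ hp).2.1.1, (hfacts _ _ _ hp).2.2.1.1,
      (hfacts _ _ _ hp).2.2.2.2⟩) (hwnat a haG) (hwnat b hbG) hc (ρ ^ (k + 2)) hρ.ge (by
      have h4 : (k + 1) * (τ / b) ≤ θ := by
        rw [mul_div_assoc', div_le_iff₀ hbR]
        calc (k + 1) * τ ≤ G * (G * θ) := by
              refine mul_le_mul ?_ hτθ hτ0.le hG0.le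
              linarith
          _ = θ * G ^ 2 := by ring
          _ ≤ θ * b := by gcongr
      have h5 : (#T : ℝ) = 2 * θ := by rw [hθ]; ring
      rw [h5]
      linarith) hest1
  rw [hη] at hest2
  refine hgoal' _ ?_ _ le_rfl hest2
  refine hcount.trans ?_
  refine mul_le_mul_of_nonneg_right ?_ (Nat.cast_nonneg _)
  refine le_trans ?_ hGK
  exact le_mul_of_one_le_left (by positivity)
    (one_le_mul_of_one_le_of_one_le (one_le_pow₀ (by norm_num)) (one_le_pow₀ (by norm_num)))

end RGraph

/-! ### Absorbing constants into powers of the logarithm -/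

theorem natLog_two_sq_add_one_le {n : ℕ} (hn : 0 < n) (h : 1 ≤ Real.log n) :
    (Nat.log 2 (n ^ 2) + 1 : ℝ) ≤ 5 * Real.log n := by
  have h1 : (2 : ℝ) ^ Nat.log 2 (n ^ 2) ≤ (n : ℝ) ^ 2 := by
    exact_mod_cast Nat.pow_log_le_self 2 (pow_pos hn 2).ne'
  have h2 := Real.log_le_log (by positivity) h1
  rw [Real.log_pow, Real.log_pow] at h2
  have h3 := Real.log_two_gt_d9
  have h4 : (0 : ℝ) ≤ Nat.log 2 (n ^ 2) := Nat.cast_nonneg _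
  push_cast at h2
  nlinarith

theorem one_lt_log_three : 1 < Real.log 3 := by
  rw [Real.lt_log_iff_exp_lt (by norm_num)]
  linarith [Real.exp_one_lt_d9]

namespace RGraph

theorem card_edges_eq_zero {n r : ℕ} (H : RGraph (Fin n) r) (hn : n < r) : #H.edges = 0 := by
  rw [card_eq_zero, eq_empty_iff_forall_notMem]
  intro e he
  have h1 := H.uniform e he
  have h2 := card_le_univ e
  rw [Fintype.card_fin] at h2
  omega

/-- Since $\log n\ge\log 3>1$, every constant is dominated by a fixed power of $\log n$, and `G` can
be a constant times $(\log n)^4$. -/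
theorem exists_copyCount_expandedK_ge (k q : ℕ) (hk : 1 ≤ k) :
    ∃ C C' : ℕ, 0 < C ∧ 0 < C' ∧ ∀ (n : ℕ) (H : RGraph (Fin n) 3), 3 ≤ n →
      (n : ℝ) ^ (3 - 3 / (k + 2 : ℝ) + 1 / ((k + 2 : ℝ) * (q + 1))) * Real.log n ^ C ≤
        (#H.edges : ℝ) →
      (#H.edges : ℝ) ^ ((k + 2) * (q + 1)) * (n : ℝ) ^ (k + 2 + (q + 1)) ≤
        Real.log n ^ C' * copyCount (expandedK (k + 2) (q + 1)) H *
          (n : ℝ) ^ (2 * ((k + 2) * (q + 1))) := by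
  set A₁ : ℝ := 2 * (k + 2 + (q + 1) + (k + 2) * (q + 1) : ℝ) with hA₁
  set A₂ : ℝ := (2 * (k + 2 : ℝ)) ^ (k + 2) + 2 * (q + 1) * 2 ^ (k + 2) with hA₂
  set A₃ : ℝ := 4 ^ ((k + 2) * (q + 1)) * 2 ^ (q + 1) * (3 * ((k + 2 : ℝ) * (q + 1))) ^
        (k + 2 + (q + 1) + (k + 2) * (q + 1)) with hA₃
  have hA₁0 : 0 ≤ A₁ := by positivity
  have hA₂0 : 0 ≤ A₂ := by positivity
  have hA₃0 : 0 ≤ A₃ := by positivity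
  clear_value A₁ A₂ A₃
  -- Here $2500=4\cdot5^4$ bounds the number of dyadic classes, through `natLog_two_sq_add_one_le`.
  set K : ℝ := 2500 + A₁ + A₂ + A₃ with hK
  have hK1 : 1 ≤ K := by linarith
  set J := (k + 2) * (q + 1) +
        (2 * k + 2 * (q + 1) + 2 * ((q + 1) * (k + 1)) + (5 * k + 3) * q + (q + 1)) + 1 with hJ
  clear_value J
  obtain ⟨c₁, hc₁⟩ := pow_unbounded_of_one_lt (12 * K ^ (5 * k + 5)) one_lt_log_three
  obtain ⟨c₂, hc₂⟩ := pow_unbounded_of_one_lt (K ^ J) one_lt_log_three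
  refine ⟨c₁ + 4 * (5 * k + 5), c₂ + 4 * J + 1, by omega, by omega, ?_⟩
  intro n H hn hm
  have hn0 : (0 : ℝ) < n := by exact_mod_cast (by omega : 0 < n)
  have hn1 : (1 : ℝ) ≤ n := by exact_mod_cast (by omega : 1 ≤ n)
  set l := Real.log n with hl
  have hl3 : Real.log 3 ≤ l := Real.log_le_log (by norm_num) (by exact_mod_cast hn)
  have hl1 : 1 ≤ l := one_lt_log_three.le.trans hl3
  set G := K * l ^ 4 with hG
  have hKG : K ≤ G := le_mul_of_one_le_right (by linarith) (one_le_pow₀ hl1)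
  have hG1 : 1 ≤ G := hK1.trans hKG
  have hlog3 : 0 ≤ Real.log 3 := by linarith [one_lt_log_three]
  have hlC : 12 * G ^ (5 * k + 5) ≤ l ^ (c₁ + 4 * (5 * k + 5)) := by
    calc 12 * G ^ (5 * k + 5) = 12 * K ^ (5 * k + 5) * l ^ (4 * (5 * k + 5)) := by
          rw [hG, mul_pow, ← pow_mul]; ring
      _ ≤ Real.log 3 ^ c₁ * l ^ (4 * (5 * k + 5)) := by gcongr
      _ ≤ l ^ c₁ * l ^ (4 * (5 * k + 5)) := by gcongr
      _ = _ := (pow_add _ _ _).symm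
  have hlC' : G ^ J ≤ l ^ (c₂ + 4 * J + 1) := by
    calc G ^ J = K ^ J * l ^ (4 * J) := by rw [hG, mul_pow, ← pow_mul]
      _ ≤ Real.log 3 ^ c₂ * l ^ (4 * J) := by gcongr
      _ ≤ l ^ c₂ * l ^ (4 * J) := by gcongr
      _ = l ^ (c₂ + 4 * J) := (pow_add _ _ _).symm
      _ ≤ _ := pow_le_pow_right₀ hl1 (Nat.le_succ _)
  set η : ℝ := (n : ℝ) ^ (1 / (k + 2 : ℝ)) with hη
  set ζ : ℝ := (n : ℝ) ^ (1 / ((k + 2 : ℝ) * (q + 1))) with hζ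
  have hη0 : 0 ≤ η := by positivity
  have hk2 : (k + 2 : ℝ) ≠ 0 := by positivity
  have hq1 : (q + 1 : ℝ) ≠ 0 := by positivity
  have hζ1 : 1 ≤ ζ := Real.one_le_rpow hn1 (by positivity)
  have hηn : η ^ (k + 2) = n := by
    rw [hη, ← Real.rpow_natCast, ← Real.rpow_mul hn0.le]
    push_cast
    rw [one_div_mul_cancel hk2, Real.rpow_one]
  have hζη : ζ ^ (q + 1) = η := by
    rw [hζ, hη, ← Real.rpow_natCast, ← Real.rpow_mul hn0.le]
    congr 1
    push_cast
    field_simp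
  have hthr : (n : ℝ) ^ (3 - 3 / (k + 2 : ℝ) + 1 / ((k + 2 : ℝ) * (q + 1))) =
      η ^ (3 * k + 3) * ζ := by
    rw [hη, hζ, ← Real.rpow_natCast, ← Real.rpow_mul hn0.le, ← Real.rpow_add hn0]
    congr 1
    push_cast
    field_simp
    ring
  -- This is where $s\ge3$ enters: $2s\le3(s-1)$, so the edge threshold exceeds $n^2$ and codegrees
  -- are large on average.
  have hsq : (n : ℝ) ^ 2 ≤ η ^ (3 * k + 3) := by
    rw [← hηn, ← pow_mul]
    have hη1 : 1 ≤ η := Real.one_le_rpow hn1 (by positivity)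
    exact pow_le_pow_right₀ hη1 (by omega)
  have hmτ : (#H.edges : ℝ) ≤ #H.triples := by exact_mod_cast card_edges_le_card_triples H
  have hτ : η ^ (3 * k + 3) * ζ * (12 * G ^ (5 * k + 5)) ≤ #H.triples := by
    refine le_trans ?_ (hm.trans hmτ)
    rw [hthr]
    gcongr
  have hηk0 : 0 ≤ η ^ (3 * k + 3) := by positivity
  have hG0 : 0 ≤ G := by linarith
  have : NeZero n := ⟨by omega⟩
  have hmain := copyCount_expandedK_ge H k q (G := G) (η := η) hη0 (by rw [hηn]; simp)
    (by linarith) (by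
      rw [Fintype.card_fin]
      have h1 := natLog_two_sq_add_one_le (by omega : 0 < n) hl1
      calc 4 * (Nat.log 2 (n ^ 2) + 1 : ℝ) ^ 4 ≤ 4 * (5 * l) ^ 4 := by gcongr
        _ = 2500 * l ^ 4 := by ring
        _ ≤ G := by
          rw [hG]
          gcongr
          linarith) (by linarith) (by linarith) (by
      rw [Fintype.card_fin]
      refine le_trans ?_ hτ
      calc 12 * G ^ 2 * (n : ℝ) ^ 2 = (n : ℝ) ^ 2 * 1 * (12 * G ^ 2) := by ring
        _ ≤ η ^ (3 * k + 3) * ζ * (12 * G ^ (5 * k + 5)) := by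
          gcongr
          omega) (by
      refine le_trans ?_ hτ
      calc G ^ (5 * k + 5) * η ^ (3 * k + 3) = η ^ (3 * k + 3) * 1 * (1 * G ^ (5 * k + 5)) := by
            ring
        _ ≤ η ^ (3 * k + 3) * ζ * (12 * G ^ (5 * k + 5)) := by
          gcongr
          norm_num) (by
      calc η * (G * η ^ (3 * k + 3)) ^ (q + 1) = (η ^ (3 * k + 3) * ζ * (1 * G)) ^ (q + 1) := by
            rw [← hζη, ← mul_pow]
            congr 1
            ring
        _ ≤ (η ^ (3 * k + 3) * ζ * (12 * G ^ (5 * k + 5))) ^ (q + 1) := by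
          gcongr
          · norm_num
          · exact le_self_pow₀ hG1 (by omega)
        _ ≤ _ := by gcongr)
  rw [Fintype.card_fin, ← hJ] at hmain
  calc _ ≤ (#H.triples : ℝ) ^ ((k + 2) * (q + 1)) * (n : ℝ) ^ (k + 2 + (q + 1)) := by gcongr
    _ ≤ _ := hmain
    _ ≤ _ := by gcongr

end RGraph

end

/-! ### The main theorem -/

theorem proposition1p5 (s t : ℕ) (hs : 3 ≤ s) (hst : s ≤ t) :
    -- supersaturation
    (∃ C : ℝ, 0 < C ∧ ∃ C' : ℝ, 0 < C' ∧ ∀ (n : ℕ) (H : RGraph (Fin n) 3),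
      (n : ℝ) ^ (3 - 3 / (s : ℝ) + 1 / ((s : ℝ) * t)) * Real.log n ^ C ≤ (H.edges.card : ℝ) →
      Real.log n ^ (-C') *
          ((H.edges.card : ℝ) ^ (s * t) * (n : ℝ) ^ ((s : ℝ) + t - 2 * s * t)) ≤
        (RGraph.copyCount (RGraph.expandedK s t) H : ℝ)) ∧
    -- tightness
    (∃ K : ℝ, 0 < K ∧ ∀ n m : ℕ, m ≤ n.choose 3 →
      ∃ H : RGraph (Fin n) 3, H.edges.card = m ∧
        (RGraph.copyCount (RGraph.expandedK s t) H : ℝ) ≤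
          K * ((m : ℝ) ^ (s * t) * (n : ℝ) ^ ((s : ℝ) + t - 2 * s * t))) := by
  refine ⟨?_, 27 ^ (s * t), by positivity, fun n m hm =>
    RGraph.exists_copyCount_expandedK_le s t (by omega) (by omega) n m hm⟩
  obtain ⟨k, rfl⟩ : ∃ k, s = k + 2 := ⟨s - 2, by omega⟩
  obtain ⟨q, rfl⟩ : ∃ q, t = q + 1 := ⟨t - 1, by omega⟩
  obtain ⟨C, C', hC, hC', h⟩ := RGraph.exists_copyCount_expandedK_ge k q (by omega)
  refine ⟨C, by exact_mod_cast hC, C', by exact_mod_cast hC', fun n H hm => ?_⟩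
  -- With fewer than three vertices there are no edges, so the left side vanishes whatever the power
  -- of the logarithm means.
  rcases lt_or_ge n 3 with hn | hn
  · rw [RGraph.card_edges_eq_zero H hn, Nat.cast_zero,
      zero_pow (Nat.mul_pos (Nat.succ_pos _) (Nat.succ_pos _)).ne', zero_mul, mul_zero]
    exact Nat.cast_nonneg _
  · have hn0 : (0 : ℝ) < n := by exact_mod_cast (by omega : 0 < n)
    have hl : 0 < Real.log n := one_pos.trans_le (one_lt_log_three.le.trans
      (Real.log_le_log (by norm_num) (by exact_mod_cast hn)))
    rw [Real.rpow_natCast] at hm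
    push_cast at hm
    have h1 := h n H hn hm
    have hrp : (n : ℝ) ^ (((k + 2 : ℕ) : ℝ) + ((q + 1 : ℕ) : ℝ) -
        2 * ((k + 2 : ℕ) : ℝ) * ((q + 1 : ℕ) : ℝ)) =
        (n : ℝ) ^ (k + 2 + (q + 1)) / (n : ℝ) ^ (2 * ((k + 2) * (q + 1))) := by
      rw [← Real.rpow_natCast, ← Real.rpow_natCast, ← Real.rpow_sub hn0]
      congr 1
      push_cast
      ring
    rw [hrp, Real.rpow_neg hl.le, Real.rpow_natCast, inv_mul_le_iff₀ (by positivity),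
      mul_div_assoc', div_le_iff₀ (by positivity)]
    exact h1
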